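/- **Corollary 4.3.** *Conventions.* Let $\mathfrak g=\mathfrak h\oplus\mathfrak m$ be a real Lie algebra with a subalgebra $\mathfrak h$ (basis $e_1,\dots,e_k$) and a 4-dimensional complement $\mathfrak m\cong\mathfrak g/\mathfrak h$ (basis $u_1,\dots,u_4$); it determines locally a homogeneous space $G/H$. An invariant pseudo-Riemannian metric is a nondegenerate symmetric bilinear form $g$ on $\mathfrak m$ that is invariant under $\psi(x)y=[x,y]_{\mathfrak m}$, $x\in\mathfrak h$. Its Levi-Civita connection is $\Lambda:\mathfrak g\to\mathfrak{gl}(\mathfrak m)$, $\Lambda(x)y_{\mathfrak m}=\frac12[x,y]_{\mathfrak m}+v(x,y)$, where $2g(v(x,y),z_{\mathfrak m})=g(x_{\mathfrak m},[z,y]_{\mathfrak m})+g(y_{\mathfrak m},[z,x]_{\mathfrak m})$. Its curvature is $R(x,y)=[\Lambda(x),\Lambda(y)]-\Lambda([x,y])$, with $\varrho(x,y)=\operatorname{tr}(z\mapsto R(z,x)y)$, $\tau=\operatorname{tr}_g\varrho$, and $(\nabla_vR)(x,y)=[\Lambda(v),R(x,y)]-R(\Lambda(v)x,y)-R(x,\Lambda(v)y)$.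 The metric is *conformally flat* if $W=R-\frac12(\varrho-\frac\tau4g)\odot g-\frac\tau{24}\,g\odot g=0$ ($\odot$ is the Kulkarni–Nomizu product), and *(locally) symmetric* if $\nabla R=0$. It satisfies the *Ricci soliton equation* for $X\in\mathfrak m$, $\lambda\in\mathbb R$ if $$g([X,y]_{\mathfrak m},z)+g(y,[X,z]_{\mathfrak m})+\varrho(y,z)=\lambda g(y,z)\qquad(y,z\in\mathfrak m).\tag{$*$}$$ A metric is described by its components $g_{ij}=g(u_i,u_j)$; components and brackets that do not follow from those listed by symmetry are zero. The following names are those of Komrakov's classification; $a,b,c,d,p,r$ are real. *Examples.* Isotropy $[e_1,u_1]=u_1$, $[e_1,u_3]=-u_3$: * $1.1^1.1$: $[u_1,u_3]=u_2$, $[u_2,u_4]=u_2$, $[u_3,u_4]=u_3$; $g_{13}=a$, $g_{22}=0$, $g_{24}=c$, $g_{44}=d$, where $ac\ne0$ and $c^2\neq a^2$. Isotropy $[e_1,u_1]=u_3$, $[e_1,u_3]=-u_1$: * $1.1^2.1$: $[u_1,u_3]=-u_2$, $[u_1,u_4]=u_1$, $[u_2,u_4]=2u_2$, $[u_3,u_4]=u_3$;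 $g_{11}=g_{33}=a$, $g_{22}=0$, $g_{24}=c$, $g_{44}=d$, where $ac\neq0$. Isotropy $[e_1,u_3]=u_1$, $[e_1,u_4]=u_2$; metric $g_{14}=a$, $g_{23}=-a$, $g_{33}=b$, $g_{34}=c$, $g_{44}=d$ with $a\ne0$: * $1.3^1.5$ with $q=0\neq p$: $[u_1,u_3]=p^2e_1-(1+p^2)u_2$, $[u_1,u_4]=[u_2,u_3]=-pe_1+u_1+pu_2$, $[u_2,u_4]=u_2$; $2c=-pd$. * $1.3^1.7$ with $p=0$: $[u_1,u_3]=e_1-u_2$, $[u_1,u_4]=[u_2,u_3]=-e_1+u_1+u_2$, $[u_2,u_4]=u_2$; $2c=-d$. * $1.3^1.19$: $[u_1,u_4]=u_1$, $[u_2,u_3]=u_1$, $[u_2,u_4]=-e_1+u_1+2u_2$; $b=0$. * $1.3^1.21$ with $p\notin\{0,1,2\}$: $[u_1,u_4]=u_1$, $[u_2,u_3]=pu_1$, $[u_2,u_4]=-pe_1+(1-p)u_1+(1+p)u_2$, $[u_3,u_4]=(1-p)u_3$; $p=\frac12$ or $b=0$. * $1.3^1.28$: $[u_1,u_3]=2u_1$,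 $[u_1,u_4]=2u_2$, $[u_2,u_3]=u_2$, $[u_2,u_4]=e_1-\frac12u_1$, $[u_3,u_4]=u_4$; $c=0$, $b=2d$, $b-6d\neq0$. Isotropy $[e_1,u_2]=u_1$, $[e_1,u_3]=u_2$: * $1.4^1.9$ with $p=-\frac12$, $r=-\frac{a+4d}{4a}$: $[u_1,u_3]=u_1$, $[u_2,u_3]=re_1+u_2+u_4$, $[u_3,u_4]=pu_4$; $g_{13}=-a$, $g_{22}=a$, $g_{33}=b$, $g_{34}=c$, $g_{44}=d$, where $ad\neq0$ and $a+d\ne0$. Isotropy $[e_1,e_2]=e_2$, $[e_1,u_1]=u_1$, $[e_1,u_3]=-u_3$, $[e_2,u_2]=u_1$, $[e_2,u_3]=-u_4$; metric $g_{13}=g_{24}=a$, $g_{22}=c$, $g_{33}=b=0$ with $a\ne0$: * $2.2^1.2$ with $p\notin\{0,2,-2\}$: $[u_1,u_2]=e_2$, $[u_1,u_3]=u_4$, $[u_2,u_3]=(p-1)u_3$, $[u_2,u_4]=pu_4$. * $2.2^1.3$: $[u_2,u_3]=u_3$, $[u_2,u_4]=u_4$. Isotropy of dimension three: * $3.3^1.1$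 with $p\neq0$: $[e_1,e_2]=-e_2$, $[e_1,e_3]=e_3$, $[e_1,u_2]=u_2$, $[e_1,u_4]=-u_4$, $[e_2,u_2]=u_1$, $[e_2,u_3]=-u_4$, $[e_3,u_3]=-u_2$, $[e_3,u_4]=u_1$, $[u_1,u_3]=u_1$, $[u_2,u_3]=pe_3+u_2$, $[u_3,u_4]=-pe_2-u_4$; $g_{13}=g_{24}=a\neq0$, $g_{33}=b$. * $3.3^2.1$ with $p\neq0$: $[e_1,e_2]=-e_3$, $[e_1,e_3]=e_2$, $[e_1,u_2]=u_4$, $[e_1,u_4]=-u_2$, $[e_2,u_2]=u_1$, $[e_2,u_3]=-u_2$, $[e_3,u_3]=u_4$, $[e_3,u_4]=-u_1$, $[u_1,u_3]=u_1$, $[u_2,u_3]=pe_2+u_2$, $[u_3,u_4]=pe_3-u_4$; $g_{13}=g_{22}=g_{44}=a\neq0$, $g_{33}=b$. *Statement.* In each of these examples the brackets define a Lie algebra $\mathfrak g$ with a subalgebra $\mathfrak h$ that acts faithfully on $\mathfrak m$, the form $g$ is an invariant pseudo-Riemannian metric, $(*)$ holds for some $X\in\mathfrak m$ and $\lambda\in\mathbb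 R$, and $g$ is conformally flat and not symmetric ($W=0$, $\nabla R\neq0$). Correspondingly, the local homogeneous space $G/H$ exists in each case, and on every chart of $G/H$ (over which $G\to G/H$ has a section) the invariant metric satisfies $W=0$ and $\nabla R\neq0$ at every point. In every example except $1.3^1.28$, $X$ can be chosen invariant under the isotropy, and on each such chart $\mathcal L_Xg+\varrho=\lambda g$ holds for some smooth vector field $X$ and real number $\lambda$. (In $1.3^1.28$ the Ricci soliton equation is understood in the sense of $(*)$, with a vector $X\in\mathfrak m$ that is not isotropy-invariant.) In particular, there exist conformally flat homogeneous pseudo-Riemannian Ricci solitons that are not symmetric: there is such a metric on $\mathbb R^4$ whose isometries act transitively. -/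

import Mathlib

open scoped ContDiff Matrix

noncomputable section

namespace HomSoliton

/-! ## Linear algebra on a four-dimensional tangent space

A tangent space is `Fin 4 → ℝ`; the indices `0, 1, 2, 3` stand for the basis vectors
`u₁, u₂, u₃, u₄` (or for the four coordinates of a chart).  Only the smooth structure of
`Fin 4 → ℝ` is used, its norm plays no role.  A scalar product is given by its Gram matrix. -/

/-- The model tangent space. -/
abbrev Tan : Type := Fin 4 → ℝ

/-- The bilinear form with Gram matrix `B`. -/
def form (B : Matrix (Fin 4) (Fin 4) ℝ) (x y : Tan) : ℝ := x ⬝ᵥ (B *ᵥ y)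

/-- The `i`-th basis vector. -/
def basisVec (i : Fin 4) : Tan := Pi.single i 1

/-- The Ricci tensor `ϱ(x, y) = tr (z ↦ R(z, x) y)` of a curvature tensor `R x y z = R(x, y) z`. -/
def ricci (R : Tan → Tan → Tan → Tan) (x y : Tan) : ℝ := ∑ r, R (basisVec r) x y r

/-- The scalar curvature `τ = ∑ gⁱʲ ϱᵢⱼ`. -/
def scalarCurv (B : Matrix (Fin 4) (Fin 4) ℝ) (R : Tan → Tan → Tan → Tan) : ℝ :=
  ∑ i, ∑ j, B⁻¹ i j * ricci R (basisVec i) (basisVec j)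

/-- The Kulkarni–Nomizu product of two symmetric two-tensors. -/
def kulkarniNomizu (h k : Tan → Tan → ℝ) (x y z w : Tan) : ℝ :=
  h x z * k y w + h y w * k x z - h x w * k y z - h y z * k x w

/-- The Weyl tensor in dimension `n = 4`,
`W = R - 1/(n-2) (ϱ - τ/n g) ⊙ g - τ/(2n(n-1)) g ⊙ g`, where `R(x,y,z,w) = g(R(x,y)w, z)`. -/
def weyl (B : Matrix (Fin 4) (Fin 4) ℝ) (R : Tan → Tan → Tan → Tan) (x y z w : Tan) : ℝ :=
  form B (R x y w) z
    - 1 / 2 * kulkarniNomizu (fun s t => ricci R s t - scalarCurv B R / 4 * form B s t)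
        (form B) x y z w
    - scalarCurv B R / 24 * kulkarniNomizu (form B) (form B) x y z w

/-! ## Pseudo-Riemannian geometry on an open subset of `ℝ⁴`

The metric is the matrix-valued function `G` of its components.  A linear connection is given by
its Christoffel map: `∇_v w = Γ q v w` for constant vector fields `v`, `w`. -/

/-- `G` is a smooth pseudo-Riemannian metric on `U`. -/
structure IsPseudoMetric (U : Set Tan) (G : Tan → Matrix (Fin 4) (Fin 4) ℝ) : Prop where
  smooth : ∀ i j, ContDiffOn ℝ ∞ (fun q => G q i j) U
  symm : ∀ q ∈ U, (G q).IsSymm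
  nondegenerate : ∀ q ∈ U, (G q).det ≠ 0

/-- `Γ` is the Levi-Civita connection of `G` on `U`: it is smooth, torsion-free and metric. -/
structure IsLeviCivita (U : Set Tan) (G : Tan → Matrix (Fin 4) (Fin 4) ℝ)
    (Γ : Tan → Tan →L[ℝ] Tan →L[ℝ] Tan) : Prop where
  smooth : ContDiffOn ℝ ∞ Γ U
  torsion_free : ∀ q ∈ U, ∀ v w, Γ q v w = Γ q w v
  metric : ∀ q ∈ U, ∀ u v w, fderiv ℝ (fun s => form (G s) v w) q u
    = form (G q) (Γ q u v) w + form (G q) v (Γ q u w)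

/-- The curvature tensor `R(v, w) z = ∇_v ∇_w z - ∇_w ∇_v z - ∇_[v,w] z` at `q`. -/
def chartCurv (Γ : Tan → Tan →L[ℝ] Tan →L[ℝ] Tan) (q v w z : Tan) : Tan :=
  fderiv ℝ (fun s => Γ s w z) q v - fderiv ℝ (fun s => Γ s v z) q w
    + Γ q v (Γ q w z) - Γ q w (Γ q v z)

/-- The covariant derivative `(∇_u R)(v, w) z` at `q`. -/
def chartNablaCurv (Γ : Tan → Tan →L[ℝ] Tan →L[ℝ] Tan) (q u v w z : Tan) : Tan :=
  fderiv ℝ (fun s => chartCurv Γ s v w z) q u + Γ q u (chartCurv Γ q v w z)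
    - chartCurv Γ q (Γ q u v) w z - chartCurv Γ q v (Γ q u w) z - chartCurv Γ q v w (Γ q u z)

/-- The Lie derivative `(L_X G)(v, w)` at `q`. -/
def lieDerivMetric (G : Tan → Matrix (Fin 4) (Fin 4) ℝ) (X : Tan → Tan) (q v w : Tan) : ℝ :=
  fderiv ℝ (fun s => form (G s) v w) q (X q)
    + form (G q) (fderiv ℝ X q v) w + form (G q) v (fderiv ℝ X q w)

/-- `W = 0` on `U`. -/
def ConformallyFlatOn (U : Set Tan) (G : Tan → Matrix (Fin 4) (Fin 4) ℝ)
    (Γ : Tan → Tan →L[ℝ] Tan →L[ℝ] Tan) : Prop :=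
  ∀ q ∈ U, ∀ x y z w, weyl (G q) (chartCurv Γ q) x y z w = 0

/-- `∇R ≠ 0` at every point of `U`. -/
def NowhereSymmetricOn (U : Set Tan) (Γ : Tan → Tan →L[ℝ] Tan →L[ℝ] Tan) : Prop :=
  ∀ q ∈ U, ∃ u v w z, chartNablaCurv Γ q u v w z ≠ 0

/-- The Ricci soliton equation `L_X g + ϱ = μ g` holds on `U` for some smooth vector field `X` and
some real number `μ`. -/
def RicciSolitonOn (U : Set Tan) (G : Tan → Matrix (Fin 4) (Fin 4) ℝ)
    (Γ : Tan → Tan →L[ℝ] Tan →L[ℝ] Tan) : Prop :=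
  ∃ (X : Tan → Tan) (μ : ℝ), ContDiffOn ℝ ∞ X U ∧
    ∀ q ∈ U, ∀ v w, lieDerivMetric G X q v w + ricci (chartCurv Γ q) v w = μ * form (G q) v w

/-- The isometries of `(ℝ⁴, G)` act transitively: every point is mapped to every other by one. -/
def IsHomogeneousMetric (G : Tan → Matrix (Fin 4) (Fin 4) ℝ) : Prop :=
  ∀ p q : Tan, ∃ φ : Tan ≃ Tan, ContDiff ℝ ∞ φ ∧ ContDiff ℝ ∞ φ.symm ∧ φ p = q ∧
    ∀ s v w, form (G (φ s)) (fderiv ℝ φ s v) (fderiv ℝ φ s w) = form (G s) v w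

/-! ## Pairs `(𝔤, 𝔥)` and their invariant metrics

`𝔤 = 𝔥 ⊕ 𝔪` with basis `e₁, …, e_k` of `𝔥` and `u₁, …, u₄` of `𝔪 ≅ 𝔤/𝔥`. -/

/-- Labels of the basis `e₁, …, e_k, u₁, …, u₄` of `𝔤`. -/
abbrev Idx (k : ℕ) : Type := Fin k ⊕ Fin 4

/-- The underlying vector space of `𝔤`. -/
abbrev Alg (k : ℕ) : Type := Idx k → ℝ

/-- A list of the non-vanishing brackets: the entry `(i, j, v)` says that the bracket of the `i`-th
and the `j`-th basis vector is `v`. -/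
abbrev BracketTable (k : ℕ) : Type := List (Idx k × Idx k × Alg k)

/-- The skew-symmetric bilinear bracket on `𝔤` with the given table. -/
def bracket {k : ℕ} (L : BracketTable k) (x y : Alg k) : Alg k :=
  (L.map fun t => (x t.1 * y t.2.1 - x t.2.1 * y t.1) • t.2.2).sum

/-- The projection `x ↦ x_𝔪`. -/
def mPart {k : ℕ} (x : Alg k) : Tan := fun i => x (Sum.inr i)

/-- The inclusion of `𝔪` in `𝔤`. -/
def lift (k : ℕ) (w : Tan) : Alg k := Sum.elim (fun _ => 0) w

/-- The isotropy representation `ψ(x) y = [x, y]_𝔪`. -/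
def isotropy {k : ℕ} (L : BracketTable k) (x : Alg k) (y : Tan) : Tan :=
  mPart (bracket L x (lift k y))

/-- `𝔤` is a Lie algebra, `𝔥 = {x | x_𝔪 = 0}` is a subalgebra, and the isotropy representation
of `𝔥` is faithful. -/
structure IsHomogeneousPair {k : ℕ} (L : BracketTable k) : Prop where
  jacobi : ∀ x y z, bracket L x (bracket L y z) + bracket L y (bracket L z x)
    + bracket L z (bracket L x y) = 0
  subalgebra : ∀ x y, mPart x = 0 → mPart y = 0 → mPart (bracket L x y) = 0
  faithful : ∀ x, mPart x = 0 → (∀ y, isotropy L x y = 0) → x = 0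

/-- `B` is the Gram matrix, in the basis `u₁, …, u₄`, of an invariant pseudo-Riemannian metric. -/
structure IsInvariantMetric {k : ℕ} (L : BracketTable k) (B : Matrix (Fin 4) (Fin 4) ℝ) :
    Prop where
  symm : B.IsSymm
  nondegenerate : B.det ≠ 0
  invariant : ∀ x, mPart x = 0 → ∀ y z, form B (isotropy L x y) z + form B y (isotropy L x z) = 0

/-- The symmetric map `v : 𝔤 × 𝔤 → 𝔪` with
`2 g(v(x, y), z_𝔪) = g(x_𝔪, [z, y]_𝔪) + g(y_𝔪, [z, x]_𝔪)`. -/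
def symMap {k : ℕ} (L : BracketTable k) (B : Matrix (Fin 4) (Fin 4) ℝ) (x y : Alg k) : Tan :=
  B⁻¹ *ᵥ fun j =>
    1 / 2 * (form B (mPart x) (mPart (bracket L (lift k (basisVec j)) y))
      + form B (mPart y) (mPart (bracket L (lift k (basisVec j)) x)))

/-- The invariant Levi-Civita connection `Λ(x) y_𝔪 = ½ [x, y]_𝔪 + v(x, y)`. -/
def conn {k : ℕ} (L : BracketTable k) (B : Matrix (Fin 4) (Fin 4) ℝ) (x : Alg k) (w : Tan) : Tan :=
  (1 / 2 : ℝ) • mPart (bracket L x (lift k w)) + symMap L B x (lift k w)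

/-- The curvature `R(x, y) = [Λ(x), Λ(y)] - Λ([x, y])` for `x, y ∈ 𝔪`. -/
def curv {k : ℕ} (L : BracketTable k) (B : Matrix (Fin 4) (Fin 4) ℝ) (x y w : Tan) : Tan :=
  conn L B (lift k x) (conn L B (lift k y) w) - conn L B (lift k y) (conn L B (lift k x) w)
    - conn L B (bracket L (lift k x) (lift k y)) w

/-- The covariant derivative `(∇_v R)(x, y) w`: the derivation `Λ(v)` applied to `R`. -/
def nablaCurv {k : ℕ} (L : BracketTable k) (B : Matrix (Fin 4) (Fin 4) ℝ) (v x y w : Tan) : Tan :=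
  conn L B (lift k v) (curv L B x y w) - curv L B (conn L B (lift k v) x) y w
    - curv L B x (conn L B (lift k v) y) w - curv L B x y (conn L B (lift k v) w)

/-- The Ricci soliton equation for `X ∈ 𝔪`:
`g([X, y]_𝔪, z) + g(y, [X, z]_𝔪) + ϱ(y, z) = μ g(y, z)`. -/
def IsSolitonVector {k : ℕ} (L : BracketTable k) (B : Matrix (Fin 4) (Fin 4) ℝ) (X : Tan) (μ : ℝ) :
    Prop :=
  ∀ y z : Tan, form B (mPart (bracket L (lift k X) (lift k y))) z
    + form B y (mPart (bracket L (lift k X) (lift k z))) + ricci (curv L B) y z = μ * form B y z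

/-- `X ∈ 𝔪` is invariant under the isotropy. -/
def IsInvariantVector {k : ℕ} (L : BracketTable k) (X : Tan) : Prop :=
  ∀ x, mPart x = 0 → isotropy L x X = 0

/-! ## Local models of the homogeneous space

On the domain `U ⊆ ℝ⁴` of a chart of `G/H`, a smooth local section `s` of `G → G/H` pulls the
Maurer–Cartan form of `G` back to a `𝔤`-valued one-form `α` on `U` that satisfies the Maurer–Cartan
equation and whose `𝔪`-part is an isomorphism on every tangent space; conversely every such `α`
arises locally in this way.  The invariant metric of `G/H` given by the scalar product `g` on `𝔪` is
`g(α(v)_𝔪, α(w)_𝔪)`. -/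

/-- `(U, α)` is a chart of the homogeneous space `G/H` with a local section of `G → G/H`. -/
structure IsLocalModel {k : ℕ} (L : BracketTable k) (U : Set Tan) (α : Tan → Tan →L[ℝ] Alg k) :
    Prop where
  isOpen : IsOpen U
  nonempty : U.Nonempty
  smooth : ContDiffOn ℝ ∞ α U
  maurerCartan : ∀ q ∈ U, ∀ v w,
    fderiv ℝ α q v w - fderiv ℝ α q w v + bracket L (α q v) (α q w) = 0
  soldering : ∀ q ∈ U, Function.Bijective fun v => mPart (α q v)

/-- The invariant metric in a local model. -/
def modelMetric {k : ℕ} (B : Matrix (Fin 4) (Fin 4) ℝ) (α : Tan → Tan →L[ℝ] Alg k) (q : Tan) :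
    Matrix (Fin 4) (Fin 4) ℝ :=
  Matrix.of fun i j => form B (mPart (α q (basisVec i))) (mPart (α q (basisVec j)))

/-! ## The assertions made about the examples -/

/-- `(𝔤, 𝔥)` with the invariant metric `B` satisfies the Ricci soliton equation for some `X ∈ 𝔪` and
some real `μ`, is conformally flat (`W = 0`) and is not locally symmetric (`∇R ≠ 0`).  The
homogeneous space exists locally, and on each of its charts the pseudo-Riemannian metric is
conformally flat and `∇R` vanishes nowhere. -/
structure IsNonsymmetricExample {k : ℕ} (L : BracketTable k) (B : Matrix (Fin 4) (Fin 4) ℝ) :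
    Prop where
  pair : IsHomogeneousPair L
  metric : IsInvariantMetric L B
  soliton : ∃ (X : Tan) (μ : ℝ), IsSolitonVector L B X μ
  weyl_eq_zero : ∀ x y z w, weyl B (curv L B) x y z w = 0
  nablaCurv_ne_zero : ∃ v x y w, nablaCurv L B v x y w ≠ 0
  exists_model : ∃ U α, IsLocalModel L U α
  models : ∀ U α, IsLocalModel L U α →
    IsPseudoMetric U (modelMetric B α) ∧ ∃ Γ, IsLeviCivita U (modelMetric B α) Γ ∧
      ConformallyFlatOn U (modelMetric B α) Γ ∧ NowhereSymmetricOn U Γ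

/-- In addition, the vector `X ∈ 𝔪` can be chosen invariant, and the equation `L_X g + ϱ = μ g`
holds for a smooth vector field on each chart of the homogeneous space. -/
structure IsNonsymmetricInvariantExample {k : ℕ} (L : BracketTable k)
    (B : Matrix (Fin 4) (Fin 4) ℝ) : Prop extends IsNonsymmetricExample L B where
  invariantSoliton : ∃ (X : Tan) (μ : ℝ), IsInvariantVector L X ∧ IsSolitonVector L B X μ
  modelSoliton : ∀ U α, IsLocalModel L U α →
    ∃ Γ, IsLeviCivita U (modelMetric B α) Γ ∧ RicciSolitonOn U (modelMetric B α) Γ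

/-! ## The examples, with Komrakov's names `n.mᵏ.q` written `n_m_k_q` -/

section Tables

/-- Labels of the basis vectors. -/
abbrev e1 {k : ℕ} : Idx (k + 1) := Sum.inl 0
/-- The label of `e₂`. -/
abbrev e2 {k : ℕ} : Idx (k + 2) := Sum.inl 1
/-- The label of `e₃`. -/
abbrev e3 {k : ℕ} : Idx (k + 3) := Sum.inl 2
/-- The label of `u₁`. -/
abbrev u1 {k : ℕ} : Idx k := Sum.inr 0
/-- The label of `u₂`. -/
abbrev u2 {k : ℕ} : Idx k := Sum.inr 1
/-- The label of `u₃`. -/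
abbrev u3 {k : ℕ} : Idx k := Sum.inr 2
/-- The label of `u₄`. -/
abbrev u4 {k : ℕ} : Idx k := Sum.inr 3

/-- The basis vector of `𝔤` with label `i`. -/
def vec {k : ℕ} (i : Idx k) : Alg k := Pi.single i 1

/-- `1.1¹.1` -/
def pair_1_1_1_1 : BracketTable 1 :=
  [(e1, u1, vec u1), (e1, u3, -vec u3),
   (u1, u3, vec u2), (u2, u4, vec u2), (u3, u4, vec u3)]

/-- `1.1².1` -/
def pair_1_1_2_1 : BracketTable 1 :=
  [(e1, u1, vec u3), (e1, u3, -vec u1),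
   (u1, u3, -vec u2), (u1, u4, vec u1), (u2, u4, (2 : ℝ) • vec u2), (u3, u4, vec u3)]

/-- `1.3¹.5`, with parameters `p` and `q ≠ 1` -/
def pair_1_3_1_5 (p q : ℝ) : BracketTable 1 :=
  [(e1, u3, vec u1), (e1, u4, vec u2),
   (u1, u3, (-((p ^ 2 + q) / (q - 1))) • vec e1 + ((1 + p ^ 2) / (q - 1)) • vec u2),
   (u1, u4, (-p) • vec e1 + vec u1 + p • vec u2),
   (u2, u3, (-p) • vec e1 + vec u1 + p • vec u2),
   (u2, u4, (-q) • vec e1 + (q + 1) • vec u2)]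

/-- `1.3¹.7`, with parameter `p ≠ -1` -/
def pair_1_3_1_7 (p : ℝ) : BracketTable 1 :=
  [(e1, u3, vec u1), (e1, u4, vec u2),
   (u1, u3, (1 / (1 + p)) • vec e1 + (p / (1 + p)) • vec u1 - (1 / (1 + p)) • vec u2),
   (u1, u4, (-(1 / (1 + p))) • vec e1 + (1 / (1 + p)) • vec u1 + (1 / (1 + p)) • vec u2),
   (u2, u3, (-(1 / (1 + p))) • vec e1 + (1 / (1 + p)) • vec u1 + (1 / (1 + p)) • vec u2),
   (u2, u4, (-(p / (1 + p))) • vec e1 + (p / (1 + p)) • vec u1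
      + ((1 + 2 * p) / (1 + p)) • vec u2)]

/-- `1.3¹.19` -/
def pair_1_3_1_19 : BracketTable 1 :=
  [(e1, u3, vec u1), (e1, u4, vec u2),
   (u1, u4, vec u1), (u2, u3, vec u1), (u2, u4, -vec e1 + vec u1 + (2 : ℝ) • vec u2)]

/-- `1.3¹.21`, with parameter `p ≠ 1` -/
def pair_1_3_1_21 (p : ℝ) : BracketTable 1 :=
  [(e1, u3, vec u1), (e1, u4, vec u2),
   (u1, u4, vec u1), (u2, u3, p • vec u1),
   (u2, u4, (-p) • vec e1 + (1 - p) • vec u1 + (1 + p) • vec u2),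
   (u3, u4, (1 - p) • vec u3)]

/-- `1.3¹.28` -/
def pair_1_3_1_28 : BracketTable 1 :=
  [(e1, u3, vec u1), (e1, u4, vec u2),
   (u1, u3, (2 : ℝ) • vec u1), (u1, u4, (2 : ℝ) • vec u2), (u2, u3, vec u2),
   (u2, u4, vec e1 - (1 / 2 : ℝ) • vec u1), (u3, u4, vec u4)]

/-- `1.4¹.9`, with parameters `p`, `r` -/
def pair_1_4_1_9 (p r : ℝ) : BracketTable 1 :=
  [(e1, u2, vec u1), (e1, u3, vec u2),
   (u1, u3, vec u1), (u2, u3, r • vec e1 + vec u2 + vec u4), (u3, u4, p • vec u4)]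

/-- `2.2¹.2`, with parameter `p` -/
def pair_2_2_1_2 (p : ℝ) : BracketTable 2 :=
  [(e1, e2, vec e2),
   (e1, u1, vec u1), (e1, u3, -vec u3), (e2, u2, vec u1), (e2, u3, -vec u4),
   (u1, u2, vec e2), (u1, u3, vec u4), (u2, u3, (p - 1) • vec u3), (u2, u4, p • vec u4)]

/-- `2.2¹.3` -/
def pair_2_2_1_3 : BracketTable 2 :=
  [(e1, e2, vec e2),
   (e1, u1, vec u1), (e1, u3, -vec u3), (e2, u2, vec u1), (e2, u3, -vec u4),
   (u2, u3, vec u3), (u2, u4, vec u4)]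

/-- `3.3¹.1`, with parameter `p` -/
def pair_3_3_1_1 (p : ℝ) : BracketTable 3 :=
  [(e1, e2, -vec e2), (e1, e3, vec e3),
   (e1, u2, vec u2), (e1, u4, -vec u4), (e2, u2, vec u1), (e2, u3, -vec u4),
   (e3, u3, -vec u2), (e3, u4, vec u1),
   (u1, u3, vec u1), (u2, u3, p • vec e3 + vec u2), (u3, u4, (-p) • vec e2 - vec u4)]

/-- `3.3².1`, with parameter `p` -/
def pair_3_3_2_1 (p : ℝ) : BracketTable 3 :=
  [(e1, e2, -vec e3), (e1, e3, vec e2),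
   (e1, u2, vec u4), (e1, u4, -vec u2), (e2, u2, vec u1), (e2, u3, -vec u2),
   (e3, u3, vec u4), (e3, u4, -vec u1),
   (u1, u3, vec u1), (u2, u3, p • vec e2 + vec u2), (u3, u4, p • vec e3 - vec u4)]

end Tables

/-! The invariant metrics, with `θ₁, …, θ₄` dual to `u₁, …, u₄`; `g₁₃ = a` is the coefficient of
`θ₁ ∘ θ₃`, and so on. -/

/-- `a θ₁∘θ₃ + b θ₂² + c θ₂∘θ₄ + d θ₄²` -/
def metric_1_1_1 (a b c d : ℝ) : Matrix (Fin 4) (Fin 4) ℝ :=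
  !![0, 0, a, 0; 0, b, 0, c; a, 0, 0, 0; 0, c, 0, d]

/-- `a θ₁² + b θ₂² + c θ₂∘θ₄ + a θ₃² + d θ₄²` -/
def metric_1_1_2 (a b c d : ℝ) : Matrix (Fin 4) (Fin 4) ℝ :=
  !![a, 0, 0, 0; 0, b, 0, c; 0, 0, a, 0; 0, c, 0, d]

/-- `a θ₁∘θ₄ - a θ₂∘θ₃ + b θ₃² + c θ₃∘θ₄ + d θ₄²` -/
def metric_1_3_1 (a b c d : ℝ) : Matrix (Fin 4) (Fin 4) ℝ :=
  !![0, 0, 0, a; 0, 0, -a, 0; 0, -a, b, c; a, 0, c, d]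

/-- `-a θ₁∘θ₃ + a θ₂² + b θ₃² + c θ₃∘θ₄ + d θ₄²` -/
def metric_1_4_1 (a b c d : ℝ) : Matrix (Fin 4) (Fin 4) ℝ :=
  !![0, 0, -a, 0; 0, a, 0, 0; -a, 0, b, c; 0, 0, c, d]

/-- `a θ₁∘θ₃ + c θ₂² + a θ₂∘θ₄ + b θ₃²` -/
def metric_2_2_1 (a b c : ℝ) : Matrix (Fin 4) (Fin 4) ℝ :=
  !![0, 0, a, 0; 0, c, 0, a; a, 0, b, 0; 0, a, 0, 0]

/-- `a θ₁∘θ₃ + a θ₂∘θ₄ + b θ₃²` -/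
def metric_3_3_1 (a b : ℝ) : Matrix (Fin 4) (Fin 4) ℝ :=
  !![0, 0, a, 0; 0, 0, 0, a; a, 0, b, 0; 0, a, 0, 0]

/-- `a θ₁∘θ₃ + a θ₂² + b θ₃² + a θ₄²` -/
def metric_3_3_2 (a b : ℝ) : Matrix (Fin 4) (Fin 4) ℝ :=
  !![0, 0, a, 0; 0, a, 0, 0; a, 0, b, 0; 0, 0, 0, a]

end HomSoliton

end

/-!
An invariant metric on the homogeneous space of a pair `(𝔤, 𝔥)` can be studied in `𝔤` alone. On a
chart with Maurer–Cartan pullback `α`, the `𝔪`-part `P` of `α` identifies each tangent space with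
`𝔪`, and the Levi-Civita connection is the gauge transform by `P` of the `𝔤𝔩(𝔪)`-valued one-form
`Λ ∘ α`. The `𝔪`-part of the Maurer–Cartan equation says that this connection is torsion-free,
skewness of `Λ(x)` says that it is metric, and since `Λ` is equivariant under the isotropy
(`conn_bracket`), the `𝔥`-part of `α` drops out of the curvature and of its covariant derivative:
`P` intertwines them with the algebraic `R` and `∇R` (`IsLocalModel.frame_chartCurv`,
`IsLocalModel.frame_chartNablaCurv`). An isotropy-invariant `X ∈ 𝔪` that satisfies the algebraic
soliton equation gives the soliton vector field `-P⁻¹ X` (`IsLocalModel.ricciSolitonOn`). Charts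
exist because a product of four one-parameter groups is a section of `G → G/H` near the origin
(`exists_isLocalModel`).

In all the examples the scalar curvature vanishes, so that `W = 0` amounts to `R = ½ ϱ ⊙ g`.
Conversely, a curvature tensor of the form `½ g(Q·,·) ⊙ g`, with `Q` self-adjoint and trace-free,
has Ricci operator `Q` and vanishing Weyl tensor (`IsRicciCurvature.weyl_eq_zero`), and it is not
parallel if `g(Q v, Λ(v) v) ≠ 0` for some `v` (`exists_nablaCurv_ne_zero`). For each pair it
therefore suffices to compute `Λ`, which the Koszul formula does without inverting the metric
(`conn_eq_of_koszul`), to check that `R` has this form, and to exhibit `v` and the soliton vector.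
Except for `1.3¹.28`, the Ricci operator is nilpotent of rank one, `ϱ` is a multiple of the square
of a one-form, and so is the Lie derivative of `g` along the null vector spanning the image of
`Q`; this vector is isotropy-invariant, and a multiple of it satisfies the soliton equation with
constant `0`.

In the pair `2.2¹.3` the complement `𝔪` is a subalgebra, so that the invariant metrics are
left-invariant metrics on a Lie group diffeomorphic to `ℝ⁴`, which gives the global example.
-/

noncomputable section

namespace HomSoliton

/-! ### Scalar products, brackets and projections -/

section Bilinear

variable {k : ℕ} (B : Matrix (Fin 4) (Fin 4) ℝ) (L : BracketTable k)

/-- The scalar product `form B` as a bilinear map. -/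
def formBilin : Tan →ₗ[ℝ] Tan →ₗ[ℝ] ℝ :=
  LinearMap.mk₂ ℝ (form B) (fun _ _ _ => by simp [form]) (fun _ _ _ => by simp [form])
    (fun _ _ _ => by simp [form, Matrix.mulVec_add])
    (fun _ _ _ => by simp [form, Matrix.mulVec_smul])

lemma formBilin_apply (x y : Tan) : formBilin B x y = form B x y := rfl

lemma form_add_left (x x' y : Tan) : form B (x + x') y = form B x y + form B x' y := by
  simp [← formBilin_apply]

lemma form_add_right (x y y' : Tan) : form B x (y + y') = form B x y + form B x y' := by
  simp [← formBilin_apply]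

lemma form_sub_left (x x' y : Tan) : form B (x - x') y = form B x y - form B x' y := by
  simp [← formBilin_apply]

lemma form_sub_right (x y y' : Tan) : form B x (y - y') = form B x y - form B x y' := by
  simp [← formBilin_apply]

lemma form_neg_left (x y : Tan) : form B (-x) y = -form B x y := by
  simp [← formBilin_apply]

lemma form_neg_right (x y : Tan) : form B x (-y) = -form B x y := by
  simp [← formBilin_apply]

lemma form_smul_left (r : ℝ) (x y : Tan) : form B (r • x) y = r * form B x y := by
  simp [← formBilin_apply]

lemma form_smul_right (r : ℝ) (x y : Tan) : form B x (r • y) = r * form B x y := by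
  simp [← formBilin_apply]

lemma form_zero_left (y : Tan) : form B 0 y = 0 := by simp [← formBilin_apply]

lemma form_zero_right (x : Tan) : form B x 0 = 0 := by simp [← formBilin_apply]

variable {B} in
lemma form_comm (hB : B.IsSymm) (x y : Tan) : form B x y = form B y x := by
  rw [form, form, Matrix.dotProduct_mulVec, ← Matrix.mulVec_transpose, hB.eq, dotProduct_comm]

variable {B} in
lemma eq_of_form_eq (hB : B.det ≠ 0) {x y : Tan} (h : ∀ z, form B x z = form B y z) : x = y := by
  have := (Matrix.nondegenerate_iff_det_ne_zero.mpr hB).eq_zero_of_ortho (v := x - y) fun z => by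
    have := form_sub_left B x y z
    rw [h z, sub_self] at this
    exact this
  exact sub_eq_zero.mp this

/-- The bracket of `𝔤` as a bilinear map. -/
def bracketBilin : Alg k →ₗ[ℝ] Alg k →ₗ[ℝ] Alg k :=
  LinearMap.mk₂ ℝ (bracket L)
    (fun x x' y => by
      rw [bracket, bracket, bracket, ← List.sum_map_add]
      congr! 3 with t
      rw [← add_smul]; congr 1; simp only [Pi.add_apply]; ring)
    (fun r x y => by
      rw [bracket, bracket, List.smul_sum, List.map_map]
      congr! 3 with t
      simp only [Function.comp_apply, smul_smul, Pi.smul_apply, smul_eq_mul]; congr 1; ring)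
    (fun x y y' => by
      rw [bracket, bracket, bracket, ← List.sum_map_add]
      congr! 3 with t
      rw [← add_smul]; congr 1; simp only [Pi.add_apply]; ring)
    (fun r x y => by
      rw [bracket, bracket, List.smul_sum, List.map_map]
      congr! 3 with t
      simp only [Function.comp_apply, smul_smul, Pi.smul_apply, smul_eq_mul]; congr 1; ring)

lemma bracketBilin_apply (x y : Alg k) : bracketBilin L x y = bracket L x y := rfl

lemma bracket_add_left (x x' y : Alg k) :
    bracket L (x + x') y = bracket L x y + bracket L x' y := by simp [← bracketBilin_apply]

lemma bracket_add_right (x y y' : Alg k) :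
    bracket L x (y + y') = bracket L x y + bracket L x y' := by simp [← bracketBilin_apply]

lemma bracket_neg_right (x y : Alg k) : bracket L x (-y) = -bracket L x y := by
  simp [← bracketBilin_apply]

lemma bracket_smul_left (r : ℝ) (x y : Alg k) :
    bracket L (r • x) y = r • bracket L x y := by simp [← bracketBilin_apply]

lemma bracket_smul_right (r : ℝ) (x y : Alg k) :
    bracket L x (r • y) = r • bracket L x y := by simp [← bracketBilin_apply]

lemma bracket_swap (x y : Alg k) : bracket L x y = -bracket L y x := by
  have : ∀ l : BracketTable k, bracket l x y + bracket l y x = 0 := by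
    intro l
    rw [bracket, bracket, ← List.sum_map_add]
    refine List.sum_eq_zero fun v hv => ?_
    obtain ⟨t, -, rfl⟩ := List.mem_map.mp hv
    rw [← add_smul]
    convert zero_smul ℝ _ using 2
    ring
  exact eq_neg_of_add_eq_zero_left (this L)

lemma bracket_self (x : Alg k) : bracket L x x = 0 :=
  self_eq_neg.mp (bracket_swap L x x)

/-- The projection `𝔤 → 𝔪` as a linear map. -/
def mPartLin : Alg k →ₗ[ℝ] Tan where
  toFun := mPart
  map_add' _ _ := rfl
  map_smul' _ _ := rfl

lemma mPartLin_apply (x : Alg k) : mPartLin x = mPart x := rfl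

lemma mPart_add (x y : Alg k) : mPart (x + y) = mPart x + mPart y := rfl

lemma mPart_neg (x : Alg k) : mPart (-x) = -mPart x := rfl

lemma mPart_sub (x y : Alg k) : mPart (x - y) = mPart x - mPart y := rfl

lemma mPart_smul (r : ℝ) (x : Alg k) : mPart (r • x) = r • mPart x := rfl

lemma mPart_zero : mPart (0 : Alg k) = 0 := rfl

lemma mPart_lift (w : Tan) : mPart (lift k w) = w := rfl

variable (k) in
/-- The inclusion `𝔪 → 𝔤` as a linear map. -/
def liftLin : Tan →ₗ[ℝ] Alg k where
  toFun := lift k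
  map_add' _ _ := by ext (i | i) <;> simp [lift]
  map_smul' _ _ := by ext (i | i) <;> simp [lift]

lemma liftLin_apply (w : Tan) : liftLin k w = lift k w := rfl

lemma lift_add (v w : Tan) : lift k (v + w) = lift k v + lift k w := (liftLin k).map_add v w

lemma lift_smul (r : ℝ) (w : Tan) : lift k (r • w) = r • lift k w := (liftLin k).map_smul r w

lemma mPart_sub_lift (x : Alg k) : mPart (x - lift k (mPart x)) = 0 := by
  rw [mPart_sub, mPart_lift, sub_self]

end Bilinear

/-! ### The invariant Levi-Civita connection -/

section Connection

variable {k : ℕ} {B : Matrix (Fin 4) (Fin 4) ℝ} {L : BracketTable k}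

/-- The right-hand side of the Koszul formula, `2 g(Λ(x) y_𝔪, z_𝔪)`. -/
def koszul (L : BracketTable k) (B : Matrix (Fin 4) (Fin 4) ℝ) (x y z : Alg k) : ℝ :=
  form B (mPart (bracket L x y)) (mPart z) + form B (mPart x) (mPart (bracket L z y))
    + form B (mPart y) (mPart (bracket L z x))

lemma eq_sum_basisVec (z : Tan) : z = ∑ j, z j • basisVec j := by
  ext i; simp [basisVec, Pi.single_apply]

lemma two_mul_form_conn (hB : B.IsSymm) (hdet : B.det ≠ 0) (x : Alg k) (w z : Tan) :
    2 * form B (conn L B x w) z = koszul L B x (lift k w) (lift k z) := by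
  have key : form B (symMap L B x (lift k w)) z = 1 / 2 *
      (form B (mPart x) (mPart (bracket L (lift k z) (lift k w)))
      + form B w (mPart (bracket L (lift k z) x))) := by
    rw [form_comm hB, form, symMap, Matrix.mulVec_mulVec,
      Matrix.mul_nonsing_inv _ hdet.isUnit, Matrix.one_mulVec, dotProduct]
    conv_rhs => rw [eq_sum_basisVec z]
    simp only [← formBilin_apply, ← bracketBilin_apply, ← liftLin_apply, ← mPartLin_apply,
      map_sum, map_smul, LinearMap.sum_apply, LinearMap.smul_apply, smul_eq_mul,
      mul_add, Finset.mul_sum, Finset.sum_add_distrib]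
    congr 1 <;> refine Finset.sum_congr rfl fun j _ => ?_
    · ring
    · change _ * (_ * formBilin B w _) = _
      ring
  rw [conn, form_add_left, form_smul_left, key, koszul, mPart_lift, mPart_lift]
  ring

/-- A vector satisfying the Koszul formula is the covariant derivative; this computes `Λ` without
inverting the Gram matrix. -/
lemma conn_eq_of_koszul (hB : B.IsSymm) (hdet : B.det ≠ 0) {x : Alg k} {w u : Tan}
    (h : ∀ z, 2 * form B u z = koszul L B x (lift k w) (lift k z)) : conn L B x w = u :=
  eq_of_form_eq hdet fun z => by linarith [h z, two_mul_form_conn (L := L) hB hdet x w z]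

/-- The connection `Λ` as a bilinear map. -/
def connBilin (L : BracketTable k) (hB : B.IsSymm) (hdet : B.det ≠ 0) :
    Alg k →ₗ[ℝ] Tan →ₗ[ℝ] Tan :=
  LinearMap.mk₂ ℝ (conn L B)
    (fun x x' w => conn_eq_of_koszul hB hdet fun z => by
      rw [form_add_left, mul_add, two_mul_form_conn hB hdet, two_mul_form_conn hB hdet]
      simp only [koszul, bracket_add_left, bracket_add_right, mPart_add, form_add_left,
        form_add_right]
      ring)
    (fun r x w => conn_eq_of_koszul hB hdet fun z => by
      rw [form_smul_left, mul_left_comm, two_mul_form_conn hB hdet]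
      simp only [koszul, bracket_smul_left, bracket_smul_right, mPart_smul, form_smul_left,
        form_smul_right]
      ring)
    (fun x w w' => conn_eq_of_koszul hB hdet fun z => by
      rw [form_add_left, mul_add, two_mul_form_conn hB hdet, two_mul_form_conn hB hdet]
      simp only [koszul, lift_add, bracket_add_right, mPart_add, form_add_left,
        form_add_right]
      ring)
    (fun r x w => conn_eq_of_koszul hB hdet fun z => by
      rw [form_smul_left, mul_left_comm, two_mul_form_conn hB hdet]
      simp only [koszul, lift_smul, bracket_smul_right, mPart_smul, form_smul_left,
        form_smul_right]
      ring)

lemma connBilin_apply (hB : B.IsSymm) (hdet : B.det ≠ 0) (x : Alg k) (w : Tan) :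
    connBilin L hB hdet x w = conn L B x w := rfl

variable (hL : IsHomogeneousPair L) (hB : IsInvariantMetric L B)

include hL in
lemma mPart_bracket_of_mPart_eq_zero {h : Alg k} (hh : mPart h = 0) (x : Alg k) :
    mPart (bracket L h x) = isotropy L h (mPart x) := by
  have := hL.subalgebra h _ hh (mPart_sub_lift x)
  rw [sub_eq_add_neg, bracket_add_right, bracket_neg_right, mPart_add, mPart_neg,
    ← sub_eq_add_neg, sub_eq_zero] at this
  exact this

include hL hB in
lemma form_bracket_add_form_bracket {h : Alg k} (hh : mPart h = 0) (x y : Alg k) :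
    form B (mPart (bracket L h x)) (mPart y) + form B (mPart x) (mPart (bracket L h y)) = 0 := by
  rw [mPart_bracket_of_mPart_eq_zero hL hh, mPart_bracket_of_mPart_eq_zero hL hh]
  exact hB.invariant h hh _ _

include hL hB in
/-- The Koszul expression only depends on the `𝔪`-parts of its last two arguments, so that the
Koszul formula holds on all of `𝔤`. -/
lemma two_mul_form_conn_mPart (x y z : Alg k) :
    2 * form B (conn L B x (mPart y)) (mPart z) = koszul L B x y z := by
  rw [two_mul_form_conn hB.symm hB.nondegenerate]
  obtain ⟨h, hh, hy⟩ : ∃ h : Alg k, mPart h = 0 ∧ y = lift k (mPart y) + h :=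
    ⟨_, mPart_sub_lift y, by abel⟩
  obtain ⟨l, hl, hz⟩ : ∃ l : Alg k, mPart l = 0 ∧ z = lift k (mPart z) + l :=
    ⟨_, mPart_sub_lift z, by abel⟩
  generalize mPart y = v at *
  generalize mPart z = w at *
  subst hy hz
  have e1 := form_bracket_add_form_bracket hL hB hh x (lift k w)
  have e2 := form_bracket_add_form_bracket hL hB hl x (lift k v)
  have e3 := hL.subalgebra l h hl hh
  simp only [koszul, bracket_add_right, bracket_add_left, mPart_add, form_add_left, form_add_right,
    hh, hl, e3, form_zero_left, form_zero_right]
  rw [bracket_swap L x h, bracket_swap L (lift k w) h]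
  simp only [mPart_neg, form_neg_left, form_neg_right, mPart_lift] at e1 e2 ⊢
  have e4 := form_comm hB.symm v (mPart (bracket L l x))
  linarith

include hL hB in
lemma conn_of_mPart_eq_zero {h : Alg k} (hh : mPart h = 0) (w : Tan) :
    conn L B h w = isotropy L h w := by
  refine conn_eq_of_koszul hB.symm hB.nondegenerate fun z => ?_
  have e := form_bracket_add_form_bracket hL hB hh (lift k w) (lift k z)
  rw [koszul, hh, form_zero_left, bracket_swap L _ h, mPart_neg, form_neg_right]
  simp only [mPart_lift] at e ⊢
  rw [isotropy]
  linarith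

include hL hB in
/-- `Λ` is torsion-free. -/
lemma conn_sub_conn (x y : Alg k) :
    conn L B x (mPart y) - conn L B y (mPart x) = mPart (bracket L x y) := by
  refine eq_of_form_eq hB.nondegenerate fun z => ?_
  have e1 := two_mul_form_conn_mPart hL hB x y (lift k z)
  have e2 := two_mul_form_conn_mPart hL hB y x (lift k z)
  rw [koszul] at e1 e2
  rw [bracket_swap L y x, mPart_neg, form_neg_left] at e2
  rw [mPart_lift] at e1 e2
  rw [form_sub_left]
  linarith

include hB in
/-- `Λ` is metric. -/
lemma form_conn_add_form_conn (x : Alg k) (v w : Tan) :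
    form B (conn L B x v) w + form B v (conn L B x w) = 0 := by
  have e1 := two_mul_form_conn (L := L) hB.symm hB.nondegenerate x v w
  have e2 := two_mul_form_conn (L := L) hB.symm hB.nondegenerate x w v
  rw [koszul, bracket_swap L x, bracket_swap L (lift k w)] at e1
  rw [koszul, bracket_swap L x] at e2
  simp only [mPart_neg, mPart_lift, form_neg_left, form_neg_right] at e1 e2
  rw [form_comm hB.symm v (conn L B x w)]
  linarith [form_comm hB.symm (mPart (bracket L (lift k v) x)) w,
    form_comm hB.symm (mPart (bracket L (lift k w) x)) v]

include hL in
lemma bracket_bracket (x y z : Alg k) :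
    bracket L x (bracket L y z) = bracket L (bracket L x y) z + bracket L y (bracket L x z) := by
  have := hL.jacobi x y z
  rw [bracket_swap L z (bracket L x y), bracket_swap L z x, bracket_neg_right] at this
  rw [← sub_eq_zero, ← this]
  abel

include hL hB in
/-- `Λ` is equivariant under the isotropy: `Λ([h, x]) = [ψ(h), Λ(x)]` for `h ∈ 𝔥`. -/
lemma conn_bracket {h : Alg k} (hh : mPart h = 0) (x : Alg k) (w : Tan) :
    conn L B (bracket L h x) w = conn L B h (conn L B x w) - conn L B x (conn L B h w) := by
  refine eq_of_form_eq hB.nondegenerate fun z => ?_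
  have hw : conn L B h w = mPart (bracket L h (lift k w)) := conn_of_mPart_eq_zero hL hB hh w
  have hz : conn L B h z = mPart (bracket L h (lift k z)) := conn_of_mPart_eq_zero hL hB hh z
  have e0 := form_conn_add_form_conn hB h (conn L B x w) z
  have e1 := two_mul_form_conn_mPart hL hB (bracket L h x) (lift k w) (lift k z)
  have e2 := two_mul_form_conn_mPart hL hB x (bracket L h (lift k w)) (lift k z)
  have e3 := two_mul_form_conn_mPart hL hB x (lift k w) (bracket L h (lift k z))
  rw [← hw] at e2
  rw [← hz] at e3
  rw [mPart_lift] at e1 e2 e3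
  rw [mPart_lift] at e1
  rw [form_sub_left]
  -- the three Koszul expressions add up to zero, by invariance of the scalar product
  have i1 := form_bracket_add_form_bracket hL hB hh (bracket L x (lift k w)) (lift k z)
  have i2 := form_bracket_add_form_bracket hL hB hh x (bracket L (lift k z) (lift k w))
  have i3 := form_bracket_add_form_bracket hL hB hh (lift k w) (bracket L (lift k z) x)
  rw [bracket_bracket hL] at i1 i2 i3
  simp only [koszul, mPart_add, form_add_left, form_add_right] at *
  linarith

end Connection

/-! ### The curvature as a tensor on `𝔤` -/

section Curvature

variable {k : ℕ} {B : Matrix (Fin 4) (Fin 4) ℝ} {L : BracketTable k}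

/-- The curvature expression on `𝔤 × 𝔤` vanishes when one argument lies in `𝔥`, by equivariance
of `Λ`. -/
lemma curv_mPart (hL : IsHomogeneousPair L) (hB : IsInvariantMetric L B)
    (x y : Alg k) (w : Tan) :
    conn L B x (conn L B y w) - conn L B y (conn L B x w) - conn L B (bracket L x y) w
      = curv L B (mPart x) (mPart y) w := by
  obtain ⟨h, hh, hx⟩ : ∃ h : Alg k, mPart h = 0 ∧ x = lift k (mPart x) + h :=
    ⟨_, mPart_sub_lift x, by abel⟩
  obtain ⟨l, hl, hy⟩ : ∃ l : Alg k, mPart l = 0 ∧ y = lift k (mPart y) + l :=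
    ⟨_, mPart_sub_lift y, by abel⟩
  generalize mPart x = u at *
  generalize mPart y = v at *
  subst hx hy
  have e1 := conn_bracket hL hB hh (lift k v) w
  have e2 := conn_bracket hL hB hl (lift k u) w
  have e3 := conn_bracket hL hB hh l w
  rw [curv]
  simp only [bracket_add_left, bracket_add_right, bracket_swap L (lift k u) l]
  simp only [← connBilin_apply hB.symm hB.nondegenerate, map_add, map_neg, LinearMap.add_apply,
    LinearMap.neg_apply] at *
  rw [e1, e2, e3]
  abel

/-- The curvature as a trilinear map. -/
def curvTrilin (L : BracketTable k) (hB : B.IsSymm) (hdet : B.det ≠ 0) :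
    Tan →ₗ[ℝ] Tan →ₗ[ℝ] Tan →ₗ[ℝ] Tan :=
  let Λ := connBilin L hB hdet
  LinearMap.mk₂ ℝ
    (fun x y => Λ (lift k x) ∘ₗ Λ (lift k y) - Λ (lift k y) ∘ₗ Λ (lift k x)
      - Λ (bracket L (lift k x) (lift k y)))
    (fun x x' y => by
      simp only [lift_add, bracket_add_left, map_add, LinearMap.add_comp, LinearMap.comp_add]
      abel)
    (fun r x y => by
      simp only [lift_smul, bracket_smul_left, map_smul, LinearMap.smul_comp, LinearMap.comp_smul,
        smul_sub])
    (fun x y y' => by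
      simp only [lift_add, bracket_add_right, map_add, LinearMap.add_comp, LinearMap.comp_add]
      abel)
    (fun r x y => by
      simp only [lift_smul, bracket_smul_right, map_smul, LinearMap.smul_comp, LinearMap.comp_smul,
        smul_sub])

lemma curvTrilin_apply (hB : B.IsSymm) (hdet : B.det ≠ 0) (x y w : Tan) :
    curvTrilin L hB hdet x y w = curv L B x y w := rfl

/-- The curvature is invariant under the isotropy, so that `∇R` extends from `𝔪` to `𝔤` by the same
formula. -/
lemma nablaCurv_mPart (hL : IsHomogeneousPair L) (hB : IsInvariantMetric L B)
    (v : Alg k) (x y w : Tan) :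
    conn L B v (curv L B x y w) - curv L B (conn L B v x) y w - curv L B x (conn L B v y) w
      - curv L B x y (conn L B v w) = nablaCurv L B (mPart v) x y w := by
  obtain ⟨h, hh, hv⟩ : ∃ h : Alg k, mPart h = 0 ∧ v = lift k (mPart v) + h :=
    ⟨_, mPart_sub_lift v, by abel⟩
  generalize mPart v = u at *
  subst hv
  have key : conn L B h (curv L B x y w) - curv L B (conn L B h x) y w
      - curv L B x (conn L B h y) w - curv L B x y (conn L B h w) = 0 := by
    have hx : conn L B h x = mPart (bracket L h (lift k x)) := conn_of_mPart_eq_zero hL hB hh x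
    have hy : conn L B h y = mPart (bracket L h (lift k y)) := conn_of_mPart_eq_zero hL hB hh y
    have cx := curv_mPart hL hB (bracket L h (lift k x)) (lift k y) w
    have cy := curv_mPart hL hB (lift k x) (bracket L h (lift k y)) w
    rw [mPart_lift, ← hx] at cx
    rw [mPart_lift, ← hy] at cy
    have e := conn_bracket hL hB hh (bracket L (lift k x) (lift k y)) w
    rw [bracket_bracket hL] at e
    have ex := fun w => conn_bracket hL hB hh (lift k x) w
    have ey := fun w => conn_bracket hL hB hh (lift k y) w
    rw [← cx, ← cy, curv, curv]
    rw [ex, ex, ey, ey]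
    simp only [← connBilin_apply hB.symm hB.nondegenerate, map_add, map_sub,
      LinearMap.add_apply] at *
    rw [← sub_eq_zero] at e
    rw [← e]
    abel
  rw [nablaCurv, ← sub_eq_zero, ← key]
  simp only [← connBilin_apply hB.symm hB.nondegenerate,
    ← curvTrilin_apply hB.symm hB.nondegenerate, map_add, LinearMap.add_apply]
  abel

end Curvature

/-! ### Curvature tensors determined by a trace-free Ricci operator -/

section Schouten

variable {B : Matrix (Fin 4) (Fin 4) ℝ}

/-- The curvature tensor `R` of the scalar product `B` has Ricci operator `Q`, vanishing scalar
curvature `tr Q = 0` and vanishing Weyl tensor. In dimension four this means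
`R = ½ (g(Q·,·) ⊙ g)`. -/
structure IsRicciCurvature (B : Matrix (Fin 4) (Fin 4) ℝ) (R : Tan → Tan → Tan → Tan)
    (Q : Tan →ₗ[ℝ] Tan) : Prop where
  trace_eq_zero : LinearMap.trace ℝ Tan Q = 0
  selfAdjoint : ∀ x y, form B (Q x) y = form B x (Q y)
  eq : ∀ x y w, R x y w = (1 / 2 : ℝ) • (form B y w • Q x - form B x w • Q y
    + form B (Q y) w • x - form B (Q x) w • y)

lemma trace_eq_sum (Q : Tan →ₗ[ℝ] Tan) :
    LinearMap.trace ℝ Tan Q = ∑ r, Q (basisVec r) r := by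
  rw [LinearMap.trace_eq_matrix_trace ℝ (Pi.basisFun ℝ (Fin 4)), Matrix.trace]
  simp [basisVec]

lemma sum_form_basisVec_mul (x y : Tan) : ∑ r, form B (basisVec r) x * y r = form B y x := by
  conv_rhs => rw [eq_sum_basisVec y]
  simp [← formBilin_apply, mul_comm]

variable {R : Tan → Tan → Tan → Tan} {Q : Tan →ₗ[ℝ] Tan}

lemma IsRicciCurvature.ricci_eq (h : IsRicciCurvature B R Q) (x y : Tan) :
    ricci R x y = form B (Q x) y := by
  have e1 : ∑ r, form B (basisVec r) y * Q x r = form B (Q x) y := sum_form_basisVec_mul y (Q x)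
  have e2 : ∑ r, form B (Q (basisVec r)) y * x r = form B (Q x) y := by
    simp only [h.selfAdjoint]
    exact sum_form_basisVec_mul _ _
  have e3 : ∑ r : Fin 4, basisVec r r = (4 : ℝ) := by simp [basisVec]
  have e4 := trace_eq_sum Q
  rw [h.trace_eq_zero] at e4
  simp only [ricci, h.eq, Pi.smul_apply, Pi.add_apply, Pi.sub_apply, smul_eq_mul,
    ← Finset.mul_sum, Finset.sum_sub_distrib, Finset.sum_add_distrib, e1, e2, e3, ← e4]
  ring

lemma IsRicciCurvature.scalarCurv_eq_zero (h : IsRicciCurvature B R Q) (hB : B.IsSymm)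
    (hdet : B.det ≠ 0) : scalarCurv B R = 0 := by
  rw [← h.trace_eq_zero, trace_eq_sum, scalarCurv]
  refine Finset.sum_congr rfl fun i _ => ?_
  have : B⁻¹ *ᵥ (B *ᵥ Q (basisVec i)) = Q (basisVec i) := by
    rw [Matrix.mulVec_mulVec, Matrix.nonsing_inv_mul _ hdet.isUnit, Matrix.one_mulVec]
  conv_rhs => rw [← this]
  rw [Matrix.mulVec, dotProduct]
  refine Finset.sum_congr rfl fun j _ => ?_
  rw [h.ricci_eq, form_comm hB]
  simp [form, basisVec]

lemma IsRicciCurvature.weyl_eq_zero (h : IsRicciCurvature B R Q) (hB : B.IsSymm)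
    (hdet : B.det ≠ 0) (x y z w : Tan) : weyl B R x y z w = 0 := by
  rw [weyl, h.scalarCurv_eq_zero hB hdet, h.eq]
  simp only [kulkarniNomizu, h.ricci_eq, form_smul_left, form_sub_left, form_add_left]
  ring

end Schouten

/-! ### The Levi-Civita connection of a local model -/

section Model

open ContinuousLinearMap

variable {k : ℕ} {B : Matrix (Fin 4) (Fin 4) ℝ} {L : BracketTable k} {U : Set Tan}
  {α : Tan → Tan →L[ℝ] Alg k}

/-- The `𝔪`-part of `α`, the soldering form: an isomorphism from the tangent space to `𝔪`. -/
def frame (α : Tan → Tan →L[ℝ] Alg k) (q : Tan) : Tan →L[ℝ] Tan :=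
  (LinearMap.toContinuousLinearMap mPartLin).comp (α q)

lemma frame_apply (q v : Tan) : frame α q v = mPart (α q v) := rfl

/-- The connection `Λ` as a continuous bilinear map. -/
def connCLM (L : BracketTable k) (hB : IsInvariantMetric L B) : Alg k →L[ℝ] Tan →L[ℝ] Tan :=
  (connBilin L hB.symm hB.nondegenerate).toContinuousBilinearMap

lemma connCLM_apply (hB : IsInvariantMetric L B) (x : Alg k) (w : Tan) :
    connCLM L hB x w = conn L B x w := rfl

/-- The connection on `U` with `P (∇_v w) = dP(v) w + Λ(α(v)) P w`, where `P` is the soldering form: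
the gauge transform by `P` of the connection form `Λ ∘ α`. -/
def modelConn (Λ : Alg k →L[ℝ] Tan →L[ℝ] Tan) (α : Tan → Tan →L[ℝ] Alg k) (q : Tan) :
    Tan →L[ℝ] Tan →L[ℝ] Tan :=
  (compL ℝ Tan Tan Tan (frame α q).inverse).comp
    (fderiv ℝ (frame α) q + ((compL ℝ Tan Tan Tan).flip (frame α q)).comp (Λ.comp (α q)))

lemma form_modelMetric (q v w : Tan) :
    form (modelMetric B α q) v w = form B (frame α q v) (frame α q w) := by
  set P : Tan →ₗ[ℝ] Tan := (frame α q).toLinearMap with hP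
  have h : ∀ i j, modelMetric B α q i j = formBilin B (P (basisVec i)) (P (basisVec j)) :=
    fun _ _ => rfl
  change _ = formBilin B (P v) (P w)
  conv_rhs => rw [eq_sum_basisVec v, eq_sum_basisVec w]
  simp only [form, Matrix.mulVec, dotProduct, h, map_sum, map_smul, LinearMap.sum_apply,
    LinearMap.smul_apply, smul_eq_mul, Finset.mul_sum]
  rw [Finset.sum_comm]
  refine Finset.sum_congr rfl fun i _ => Finset.sum_congr rfl fun j _ => ?_
  ring

variable (hα : IsLocalModel L U α)

include hα

lemma IsLocalModel.isInvertible_frame {q : Tan} (hq : q ∈ U) : (frame α q).IsInvertible :=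
  ⟨(LinearEquiv.ofBijective (frame α q).toLinearMap (hα.soldering q hq)).toContinuousLinearEquiv,
    rfl⟩

lemma IsLocalModel.frame_injective {q : Tan} (hq : q ∈ U) : Function.Injective (frame α q) :=
  (hα.soldering q hq).1

lemma IsLocalModel.frame_surjective {q : Tan} (hq : q ∈ U) : Function.Surjective (frame α q) :=
  (hα.soldering q hq).2

lemma IsLocalModel.frame_inverse {q : Tan} (hq : q ∈ U) (v : Tan) :
    frame α q ((frame α q).inverse v) = v := by
  obtain ⟨e, he⟩ := hα.isInvertible_frame hq
  rw [← he, inverse_equiv]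
  exact e.apply_symm_apply v

lemma IsLocalModel.frame_modelConn (Λ : Alg k →L[ℝ] Tan →L[ℝ] Tan) {q : Tan} (hq : q ∈ U)
    (v w : Tan) : frame α q (modelConn Λ α q v w)
      = fderiv ℝ (frame α) q v w + Λ (α q v) (frame α q w) :=
  hα.frame_inverse hq _

lemma IsLocalModel.contDiffOn_frame : ContDiffOn ℝ ∞ (frame α) U :=
  contDiffOn_const.clm_comp hα.smooth

lemma IsLocalModel.contDiffOn_inverse : ContDiffOn ℝ ∞ (fun q => (frame α q).inverse) U :=
  fun q hq => (hα.isInvertible_frame hq).contDiffAt_map_inverse.comp_contDiffWithinAt q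
    (hα.contDiffOn_frame q hq)

lemma IsLocalModel.contDiffOn_modelConn (Λ : Alg k →L[ℝ] Tan →L[ℝ] Tan) :
    ContDiffOn ℝ ∞ (modelConn Λ α) U := by
  have h1 : ContDiffOn ℝ ∞ (fderiv ℝ (frame α)) U :=
    hα.contDiffOn_frame.fderiv_of_isOpen hα.isOpen (by norm_num)
  have h2 : ContDiffOn ℝ ∞ (fun q => compL ℝ Tan Tan Tan (frame α q).inverse) U :=
    contDiffOn_const.clm_apply hα.contDiffOn_inverse
  have h3 : ContDiffOn ℝ ∞ (fun q => (compL ℝ Tan Tan Tan).flip (frame α q)) U :=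
    contDiffOn_const.clm_apply hα.contDiffOn_frame
  exact h2.clm_comp (h1.add (h3.clm_comp (contDiffOn_const.clm_comp hα.smooth)))

lemma IsLocalModel.contDiffAt_frame {q : Tan} (hq : q ∈ U) : ContDiffAt ℝ ∞ (frame α) q :=
  hα.contDiffOn_frame.contDiffAt (hα.isOpen.mem_nhds hq)

lemma IsLocalModel.differentiableAt {q : Tan} (hq : q ∈ U) : DifferentiableAt ℝ α q :=
  (hα.smooth.contDiffAt (hα.isOpen.mem_nhds hq)).differentiableAt (by norm_num)

lemma IsLocalModel.differentiableAt_frame {q : Tan} (hq : q ∈ U) :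
    DifferentiableAt ℝ (frame α) q :=
  (hα.contDiffAt_frame hq).differentiableAt (by norm_num)

lemma IsLocalModel.differentiableAt_modelConn (Λ : Alg k →L[ℝ] Tan →L[ℝ] Tan) {q : Tan}
    (hq : q ∈ U) : DifferentiableAt ℝ (modelConn Λ α) q :=
  ((hα.contDiffOn_modelConn Λ).contDiffAt (hα.isOpen.mem_nhds hq)).differentiableAt (by norm_num)

omit hα in
lemma fderiv_clm_apply_const {E F : Type*} [NormedAddCommGroup E] [NormedSpace ℝ E]
    [NormedAddCommGroup F] [NormedSpace ℝ F] {A : Tan → E →L[ℝ] F} {q : Tan}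
    (hA : DifferentiableAt ℝ A q) (v : Tan) (w : E) :
    fderiv ℝ (fun s => A s w) q v = fderiv ℝ A q v w := by
  rw [fderiv_clm_apply hA (differentiableAt_const w)]
  simp

omit hα in
lemma fderiv_clm_apply_apply {E F : Type*} [NormedAddCommGroup E] [NormedSpace ℝ E]
    [NormedAddCommGroup F] [NormedSpace ℝ F] {A : Tan → E →L[ℝ] F} {f : Tan → E} {q : Tan}
    (hA : DifferentiableAt ℝ A q) (hf : DifferentiableAt ℝ f q) (v : Tan) :
    fderiv ℝ (fun s => A s (f s)) q v = fderiv ℝ A q v (f q) + A q (fderiv ℝ f q v) := by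
  rw [fderiv_clm_apply hA hf]
  simp [add_comm]

omit hα in
lemma fderiv_clm_comp_const {E F G : Type*} [NormedAddCommGroup E] [NormedSpace ℝ E]
    [NormedAddCommGroup F] [NormedSpace ℝ F] [NormedAddCommGroup G] [NormedSpace ℝ G]
    (Φ : E →L[ℝ] F →L[ℝ] G) {f : Tan → E} {g : Tan → F} {q : Tan}
    (hf : DifferentiableAt ℝ f q) (hg : DifferentiableAt ℝ g q) (v : Tan) :
    fderiv ℝ (fun s => Φ (f s) (g s)) q v
      = Φ (fderiv ℝ f q v) (g q) + Φ (f q) (fderiv ℝ g q v) := by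
  rw [fderiv_clm_apply_apply (A := fun s => Φ (f s)) (Φ.differentiableAt.comp q hf) hg]
  congr 2
  rw [show (fun s => Φ (f s)) = Φ ∘ f from rfl, fderiv_comp q Φ.differentiableAt hf, Φ.fderiv]
  rfl

lemma IsLocalModel.fderiv_frame {q : Tan} (hq : q ∈ U) (v w : Tan) :
    fderiv ℝ (frame α) q v w = mPart (fderiv ℝ α q v w) := by
  have h : HasFDerivAt (frame α) _ q :=
    (hasFDerivAt_const (LinearMap.toContinuousLinearMap (mPartLin (k := k))) q).clm_comp
      (hα.differentiableAt hq).hasFDerivAt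
  rw [h.fderiv]
  simp [← mPartLin_apply]

/-- `∇` is torsion-free: the `𝔪`-part of the Maurer–Cartan equation is the first structure
equation. -/
lemma IsLocalModel.modelConn_comm (hL : IsHomogeneousPair L) (hB : IsInvariantMetric L B) {q : Tan}
    (hq : q ∈ U) (v w : Tan) :
    modelConn (connCLM L hB) α q v w = modelConn (connCLM L hB) α q w v := by
  refine hα.frame_injective hq ?_
  rw [hα.frame_modelConn _ hq, hα.frame_modelConn _ hq, hα.fderiv_frame hq, hα.fderiv_frame hq]
  have h1 := congrArg mPart (hα.maurerCartan q hq v w)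
  have h2 := conn_sub_conn hL hB (α q v) (α q w)
  rw [mPart_add, mPart_sub, mPart_zero, ← h2] at h1
  rw [connCLM_apply, connCLM_apply, frame_apply, frame_apply, ← sub_eq_zero, ← h1]
  abel

lemma IsLocalModel.fderiv_form_modelMetric {q : Tan} (hq : q ∈ U) (u v w : Tan) :
    fderiv ℝ (fun s => form (modelMetric B α s) v w) q u
      = form B (fderiv ℝ (frame α) q u v) (frame α q w)
        + form B (frame α q v) (fderiv ℝ (frame α) q u w) := by
  simp only [form_modelMetric]
  have hd := hα.differentiableAt_frame hq
  have := fderiv_clm_comp_const (formBilin B).toContinuousBilinearMap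
    (f := fun s => frame α s v) (g := fun s => frame α s w) (q := q)
    (hd.clm_apply (differentiableAt_const v)) (hd.clm_apply (differentiableAt_const w)) u
  rw [fderiv_clm_apply_const hd, fderiv_clm_apply_const hd] at this
  exact this

lemma IsLocalModel.isPseudoMetric (hB : IsInvariantMetric L B) :
    IsPseudoMetric U (modelMetric B α) where
  smooth i j := by
    have h : ∀ i, ContDiffOn ℝ ∞ (fun q => frame α q (basisVec i)) U := fun i =>
      hα.contDiffOn_frame.clm_apply contDiffOn_const
    have h1 : ContDiffOn ℝ ∞ (fun q => (formBilin B).toContinuousBilinearMap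
        (frame α q (basisVec i)) (frame α q (basisVec j))) U :=
      (contDiffOn_const.clm_apply (h i)).clm_apply (h j)
    exact h1
  symm q _ := by
    ext i j
    exact form_comm hB.symm _ _
  nondegenerate q hq := by
    intro hdet
    obtain ⟨v, hv, hGv⟩ := Matrix.exists_mulVec_eq_zero_iff.mpr hdet
    refine hv (hα.frame_injective hq ?_)
    rw [map_zero]
    refine eq_of_form_eq hB.nondegenerate fun z => ?_
    obtain ⟨w, rfl⟩ := hα.frame_surjective hq z
    rw [form_comm hB.symm, ← form_modelMetric, form, hGv, dotProduct_zero, form_zero_left]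

lemma IsLocalModel.isLeviCivita (hL : IsHomogeneousPair L) (hB : IsInvariantMetric L B) :
    IsLeviCivita U (modelMetric B α) (modelConn (connCLM L hB) α) where
  smooth := hα.contDiffOn_modelConn _
  torsion_free _ hq v w := hα.modelConn_comm hL hB hq v w
  metric q hq u v w := by
    rw [hα.fderiv_form_modelMetric hq, form_modelMetric, form_modelMetric,
      hα.frame_modelConn _ hq, hα.frame_modelConn _ hq, form_add_left, form_add_right,
      connCLM_apply, connCLM_apply]
    linarith [form_conn_add_form_conn hB (α q u) (frame α q v) (frame α q w)]

/-- The second structure equation: the soldering form intertwines the curvature of the chart with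
the algebraic curvature. -/
lemma IsLocalModel.frame_chartCurv (hL : IsHomogeneousPair L) (hB : IsInvariantMetric L B)
    {q : Tan} (hq : q ∈ U) (v w z : Tan) :
    frame α q (chartCurv (modelConn (connCLM L hB) α) q v w z)
      = curv L B (frame α q v) (frame α q w) (frame α q z) := by
  set Γ := modelConn (connCLM L hB) α with hΓ
  have hP := hα.differentiableAt_frame hq
  have hG : DifferentiableAt ℝ Γ q := hα.differentiableAt_modelConn _ hq
  have hdP : DifferentiableAt ℝ (fderiv ℝ (frame α)) q :=
    ((hα.contDiffAt_frame hq).fderiv_right (m := 1)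
      (by norm_num; exact ENat.LEInfty.out)).differentiableAt (by norm_num)
  have hA := hα.differentiableAt hq
  have d1 : ∀ v w, frame α q (fderiv ℝ (fun s => Γ s w z) q v)
      = fderiv ℝ (fderiv ℝ (frame α)) q v w z
        + (connCLM L hB (fderiv ℝ α q v w) (frame α q z)
          + connCLM L hB (α q w) (fderiv ℝ (frame α) q v z))
        - fderiv ℝ (frame α) q v (Γ q w z) := by
    intro v w
    have heq : (fun s => frame α s (Γ s w z)) =ᶠ[nhds q]
        fun s => fderiv ℝ (frame α) s w z + connCLM L hB (α s w) (frame α s z) := by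
      filter_upwards [hα.isOpen.mem_nhds hq] with s hs
      exact hα.frame_modelConn _ hs w z
    have h1 : DifferentiableAt ℝ (fun s => Γ s w z) q :=
      (hG.clm_apply (differentiableAt_const w)).clm_apply (differentiableAt_const z)
    have h2 : DifferentiableAt ℝ (fun s => fderiv ℝ (frame α) s w) q :=
      hdP.clm_apply (differentiableAt_const w)
    have h3 : DifferentiableAt ℝ (fun s => α s w) q := hA.clm_apply (differentiableAt_const w)
    have h4 : DifferentiableAt ℝ (fun s => frame α s z) q :=
      hP.clm_apply (differentiableAt_const z)
    have h5 : DifferentiableAt ℝ (fun s => connCLM L hB (α s w) (frame α s z)) q :=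
      ((differentiableAt_const (connCLM L hB)).clm_apply h3).clm_apply h4
    have e := congrArg (fun T => T v) (heq.fderiv_eq (𝕜 := ℝ))
    rw [fderiv_clm_apply_apply hP h1,
      fderiv_fun_add (h2.clm_apply (differentiableAt_const z)) h5, add_apply,
      fderiv_clm_apply_const h2, fderiv_clm_comp_const _ h3 h4] at e
    have e2 : fderiv ℝ (fun s => fderiv ℝ (frame α) s w) q v
        = fderiv ℝ (fderiv ℝ (frame α)) q v w := fderiv_clm_apply_const hdP v w
    rw [e2, fderiv_clm_apply_const hA, fderiv_clm_apply_const hP] at e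
    exact eq_sub_of_add_eq' e
  have hsymm : fderiv ℝ (fderiv ℝ (frame α)) q v w = fderiv ℝ (fderiv ℝ (frame α)) q w v :=
    ((hα.contDiffAt_frame hq).isSymmSndFDerivAt
      (by simpa using ENat.LEInfty.out)).eq v w
  have hMC : fderiv ℝ α q v w
      = fderiv ℝ α q w v - bracket L (α q v) (α q w) := by
    rw [← sub_eq_zero, ← hα.maurerCartan q hq v w]; abel
  have hc := curv_mPart hL hB (α q v) (α q w) (frame α q z)
  rw [chartCurv, map_sub, map_add, map_sub, d1, d1, hα.frame_modelConn _ hq,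
    hα.frame_modelConn _ hq, hα.frame_modelConn _ hq, hα.frame_modelConn _ hq, hsymm, hMC]
  refine Eq.trans ?_ hc
  simp only [map_sub, map_add, sub_apply, connCLM_apply]
  abel

set_option maxSynthPendingDepth 3 in
/-- The soldering form intertwines `∇R` of the chart with its algebraic counterpart. -/
lemma IsLocalModel.frame_chartNablaCurv (hL : IsHomogeneousPair L) (hB : IsInvariantMetric L B)
    {q : Tan} (hq : q ∈ U) (u v w z : Tan) :
    frame α q (chartNablaCurv (modelConn (connCLM L hB) α) q u v w z)
      = nablaCurv L B (frame α q u) (frame α q v) (frame α q w) (frame α q z) := by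
  set Γ := modelConn (connCLM L hB) α with hΓ
  have hP := hα.differentiableAt_frame hq
  -- the curvature as a continuous trilinear map
  let C : Tan →L[ℝ] Tan →L[ℝ] Tan →L[ℝ] Tan :=
    ((curvTrilin L hB.symm hB.nondegenerate).compr₂
      (LinearMap.toContinuousLinearMap : (Tan →ₗ[ℝ] Tan) ≃ₗ[ℝ] Tan →L[ℝ] Tan).toLinearMap
      ).toContinuousBilinearMap
  have hC : ∀ x y z, C x y z = curv L B x y z := fun _ _ _ => rfl
  have hPv : ∀ v, DifferentiableAt ℝ (fun s => frame α s v) q := fun v =>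
    hP.clm_apply (differentiableAt_const v)
  have hCvw : DifferentiableAt ℝ (fun s => C (frame α s v) (frame α s w)) q :=
    ((differentiableAt_const C).clm_apply (hPv v)).clm_apply (hPv w)
  have hR : DifferentiableAt ℝ (fun s => chartCurv Γ s v w z) q := by
    have heq : (fun s => chartCurv Γ s v w z) =ᶠ[nhds q]
        fun s => (frame α s).inverse (C (frame α s v) (frame α s w) (frame α s z)) := by
      filter_upwards [hα.isOpen.mem_nhds hq] with s hs
      refine hα.frame_injective hs ?_
      rw [hα.frame_inverse hs, hα.frame_chartCurv hL hB hs, hC]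
    refine DifferentiableAt.congr_of_eventuallyEq ?_ heq
    exact ((hα.contDiffOn_inverse.contDiffAt (hα.isOpen.mem_nhds hq)).differentiableAt
      (by norm_num)).clm_apply (hCvw.clm_apply (hPv z))
  have heq : (fun s => frame α s (chartCurv Γ s v w z)) =ᶠ[nhds q]
      fun s => C (frame α s v) (frame α s w) (frame α s z) := by
    filter_upwards [hα.isOpen.mem_nhds hq] with s hs
    rw [hα.frame_chartCurv hL hB hs, hC]
  have e := congrArg (fun T => T u) (heq.fderiv_eq (𝕜 := ℝ))
  rw [fderiv_clm_apply_apply hP hR, fderiv_clm_apply_apply hCvw (hPv z),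
    fderiv_clm_comp_const C (hPv v) (hPv w), fderiv_clm_apply_const hP, fderiv_clm_apply_const hP,
    fderiv_clm_apply_const hP, add_apply, hC, hC, hC] at e
  have hn := nablaCurv_mPart hL hB (α q u) (frame α q v) (frame α q w) (frame α q z)
  rw [chartNablaCurv, map_sub, map_sub, map_sub, map_add, eq_sub_of_add_eq' e]
  simp only [hΓ, hα.frame_modelConn _ hq, hα.frame_chartCurv hL hB hq]
  refine Eq.trans ?_ hn
  simp only [← hC, map_add, add_apply, connCLM_apply]
  abel

/-- The curvature of the chart has the Ricci operator `P⁻¹ Q P`. -/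
lemma IsLocalModel.isRicciCurvature (hL : IsHomogeneousPair L) (hB : IsInvariantMetric L B)
    {Q : Tan →ₗ[ℝ] Tan} (hQ : IsRicciCurvature B (curv L B) Q) {q : Tan} (hq : q ∈ U) :
    IsRicciCurvature (modelMetric B α q) (chartCurv (modelConn (connCLM L hB) α) q)
      ((frame α q).inverse.toLinearMap ∘ₗ Q ∘ₗ (frame α q).toLinearMap) where
  trace_eq_zero := by
    obtain ⟨e, he⟩ := hα.isInvertible_frame hq
    rw [← hQ.trace_eq_zero, ← he, inverse_equiv]
    exact LinearMap.trace_conj' Q e.symm.toLinearEquiv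
  selfAdjoint x y := by
    rw [form_modelMetric, form_modelMetric]
    simp only [LinearMap.comp_apply, ContinuousLinearMap.coe_coe, hα.frame_inverse hq]
    exact hQ.selfAdjoint _ _
  eq x y w := by
    refine hα.frame_injective hq ?_
    simp only [hα.frame_chartCurv hL hB hq, hQ.eq, map_smul, map_add, map_sub, form_modelMetric,
      LinearMap.comp_apply, ContinuousLinearMap.coe_coe, hα.frame_inverse hq]

/-- If `X ∈ 𝔪` is isotropy-invariant, the vector field `-P⁻¹ X` satisfies the Ricci soliton equation
on the chart; the sign comes from `∇X = Λ(·) X`, which is `-[X, ·]_𝔪` up to a skew endomorphism. -/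
lemma IsLocalModel.ricciSolitonOn (hL : IsHomogeneousPair L) (hB : IsInvariantMetric L B)
    {Q : Tan →ₗ[ℝ] Tan} (hQ : IsRicciCurvature B (curv L B) Q) {X : Tan} {μ : ℝ}
    (hX : IsInvariantVector L X) (hsol : IsSolitonVector L B X μ) :
    RicciSolitonOn U (modelMetric B α) (modelConn (connCLM L hB) α) := by
  have hXsm : ContDiffOn ℝ ∞ (fun q => (frame α q).inverse (-X)) U :=
    hα.contDiffOn_inverse.clm_apply contDiffOn_const
  refine ⟨fun q => (frame α q).inverse (-X), μ, hXsm, fun q hq v w => ?_⟩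
  set Y : Tan → Tan := fun q => (frame α q).inverse (-X) with hY
  have hYd : DifferentiableAt ℝ Y q :=
    (hXsm.contDiffAt (hα.isOpen.mem_nhds hq)).differentiableAt (by norm_num)
  have hPY : frame α q (Y q) = -X := hα.frame_inverse hq _
  have hdY : ∀ v, frame α q (fderiv ℝ Y q v) = -fderiv ℝ (frame α) q v (Y q) := by
    intro v
    have heq : (fun s => frame α s (Y s)) =ᶠ[nhds q] fun _ => -X := by
      filter_upwards [hα.isOpen.mem_nhds hq] with s hs
      exact hα.frame_inverse hs _
    have e := congrArg (fun T => T v) (heq.fderiv_eq (𝕜 := ℝ))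
    rw [fderiv_clm_apply_apply (hα.differentiableAt_frame hq) hYd] at e
    simp only [fderiv_fun_const, Pi.zero_apply, zero_apply] at e
    exact eq_neg_of_add_eq_zero_right e
  -- the covariant derivative of the vector field
  have hcov : ∀ v, fderiv ℝ (frame α) q (Y q) v + frame α q (fderiv ℝ Y q v)
      = mPart (bracket L (lift k X) (lift k (frame α q v)))
        - conn L B (lift k X) (frame α q v)
        - conn L B (α q (Y q)) (frame α q v) := by
    intro v
    have e := congrArg (fun T => frame α q T) (hα.modelConn_comm hL hB hq (Y q) v)
    rw [hα.frame_modelConn _ hq, hα.frame_modelConn _ hq, hPY, connCLM_apply, connCLM_apply] at e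
    have hinv : conn L B (α q v) X = conn L B (lift k (frame α q v)) X := by
      have h0 := mPart_sub_lift (α q v)
      have := conn_of_mPart_eq_zero hL hB h0 X
      rw [hX _ h0, ← connBilin_apply hB.symm hB.nondegenerate, map_sub, LinearMap.sub_apply,
        sub_eq_zero] at this
      exact this
    have ht := conn_sub_conn hL hB (lift k X) (lift k (frame α q v))
    rw [mPart_lift, mPart_lift] at ht
    rw [hdY, ← ht, ← hinv, ← sub_eq_zero]
    rw [← sub_eq_zero] at e
    rw [← e]
    simp only [← connBilin_apply hB.symm hB.nondegenerate, map_neg]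
    abel
  have hsk1 := form_conn_add_form_conn hB (lift k X) (frame α q v) (frame α q w)
  have hsk2 := form_conn_add_form_conn hB (α q (Y q)) (frame α q v) (frame α q w)
  have hs := hsol (frame α q v) (frame α q w)
  have hric := (hα.isRicciCurvature hL hB hQ hq).ricci_eq v w
  rw [form_modelMetric] at hric
  simp only [LinearMap.comp_apply, ContinuousLinearMap.coe_coe, hα.frame_inverse hq,
    ← hQ.ricci_eq] at hric
  have c1 := congrArg (fun T => form B T (frame α q w)) (hcov v)
  have c2 := congrArg (fun T => form B (frame α q v) T) (hcov w)
  simp only [form_add_left, form_add_right, form_sub_left, form_sub_right] at c1 c2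
  rw [lieDerivMetric, hα.fderiv_form_modelMetric hq, form_modelMetric, form_modelMetric,
    form_modelMetric, hric]
  linarith

end Model

/-! ### Existence of a local model -/

section Existence

open NormedSpace

variable {k : ℕ} {L : BracketTable k}

/-- The bracket as a continuous bilinear map, so that `bracketCLM L u = ad u`. -/
def bracketCLM (L : BracketTable k) : Alg k →L[ℝ] Alg k →L[ℝ] Alg k :=
  (bracketBilin L).toContinuousBilinearMap

lemma bracketCLM_apply (x y : Alg k) : bracketCLM L x y = bracket L x y := rfl

lemma exp_neg_smul_exp_smul_apply (D : Alg k →L[ℝ] Alg k) (t : ℝ) (x : Alg k) :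
    exp ((-t) • D) (exp (t • D) x) = x := by
  have h : exp ((-t) • D) * exp (t • D) = 1 := by
    let : NormedAlgebra ℚ (Alg k →L[ℝ] Alg k) := .restrictScalars ℚ ℝ _
    rw [← exp_add_of_commute (((Commute.refl D).smul_left _).smul_right _), ← add_smul,
      neg_add_cancel, zero_smul, exp_zero]
  exact congrArg (fun T : Alg k →L[ℝ] Alg k => T x) h

/-- `exp (t ad u)` is an automorphism of the Lie algebra `𝔤`, since
`exp (-t ad u) [exp (t ad u) x, exp (t ad u) y]` does not depend on `t`. -/
lemma exp_smul_ad_bracket (hL : IsHomogeneousPair L) (u x y : Alg k) (t : ℝ) :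
    exp (t • bracketCLM L u) (bracket L x y)
      = bracket L (exp (t • bracketCLM L u) x) (exp (t • bracketCLM L u) y) := by
  set D := bracketCLM L u with hD
  have hx : ∀ z t, HasDerivAt (fun t : ℝ => exp (t • D) z) (D (exp (t • D) z)) t := fun z t => by
    simpa using (hasDerivAt_exp_smul_const' D t).clm_apply (hasDerivAt_const t z)
  have hn : ∀ t, HasDerivAt (fun t : ℝ => exp ((-t) • D)) (-(exp ((-t) • D) * D)) t := fun t => by
    have h : HasDerivAt (fun t : ℝ => exp ((-t) • D)) _ t :=
      (hasDerivAt_exp_smul_const D (-t)).scomp t (hasDerivAt_neg t)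
    exact h.congr_deriv (neg_one_smul ℝ _)
  have hb : ∀ t, HasDerivAt (fun t : ℝ => bracket L (exp (t • D) x) (exp (t • D) y))
      (D (bracket L (exp (t • D) x) (exp (t • D) y))) t := fun t => by
    have h := ((hasDerivAt_const t (bracketCLM L)).clm_apply (hx x t)).clm_apply (hx y t)
    refine h.congr_deriv ?_
    have e := bracket_bracket hL u (exp (t • D) x) (exp (t • D) y)
    simp only [← bracketCLM_apply, ← hD] at e
    rw [← bracketCLM_apply, e]
    simp
  have hf : ∀ t, HasDerivAt
      (fun t : ℝ => exp ((-t) • D) (bracket L (exp (t • D) x) (exp (t • D) y))) 0 t := fun t =>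
    ((hn t).clm_apply (hb t)).congr_deriv (by simp)
  have h0 := is_const_of_deriv_eq_zero (fun t => (hf t).differentiableAt)
    (fun t => (hf t).deriv) t 0
  simp only [neg_zero, zero_smul, exp_zero, one_apply_eq_self] at h0
  rw [← h0]
  simpa using exp_neg_smul_exp_smul_apply D (-t) _

/-- The one-form `dℓ ⊗ u + exp (-ℓ ad u) β`: if `β` is the Maurer–Cartan form of a section `s`, this
is the one of `s exp (ℓ u)`. -/
def gaugeForm (L : BracketTable k) (u : Alg k) (ℓ : Tan →L[ℝ] ℝ) (β : Tan → Tan →L[ℝ] Alg k)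
    (q : Tan) : Tan →L[ℝ] Alg k :=
  ℓ.smulRight u + (exp ((-ℓ q) • bracketCLM L u)).comp (β q)

lemma contDiff_gaugeForm (u : Alg k) (ℓ : Tan →L[ℝ] ℝ) {β : Tan → Tan →L[ℝ] Alg k}
    (hβ : ContDiff ℝ ∞ β) : ContDiff ℝ ∞ (gaugeForm L u ℓ β) := by
  have h1 : ContDiff ℝ ∞ (exp : (Alg k →L[ℝ] Alg k) → (Alg k →L[ℝ] Alg k)) :=
    AnalyticOnNhd.contDiff fun x _ => exp_analytic x
  have h2 : ContDiff ℝ ∞ fun q => (-ℓ q) • bracketCLM L u :=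
    ℓ.contDiff.neg.smul contDiff_const
  exact contDiff_const.add ((h1.comp h2).clm_comp hβ)

/-- The Maurer–Cartan equation is preserved by `gaugeForm`. -/
lemma maurerCartan_gaugeForm (hL : IsHomogeneousPair L) (u : Alg k) (ℓ : Tan →L[ℝ] ℝ)
    {β : Tan → Tan →L[ℝ] Alg k} (hβ : ContDiff ℝ ∞ β)
    (hMC : ∀ q v w, fderiv ℝ β q v w - fderiv ℝ β q w v + bracket L (β q v) (β q w) = 0)
    (q v w : Tan) :
    fderiv ℝ (gaugeForm L u ℓ β) q v w - fderiv ℝ (gaugeForm L u ℓ β) q w v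
      + bracket L (gaugeForm L u ℓ β q v) (gaugeForm L u ℓ β q w) = 0 := by
  set D := bracketCLM L u with hD
  have hE : HasFDerivAt (fun q => exp ((-ℓ q) • D))
      ((-ℓ).smulRight (D * exp ((-ℓ q) • D))) q := by
    have h := (hasDerivAt_exp_smul_const' D (-ℓ q)).hasFDerivAt.comp (f := fun q => -ℓ q) q
      ℓ.hasFDerivAt.neg
    exact h.congr_fderiv rfl
  have hd : HasFDerivAt (gaugeForm L u ℓ β) _ q :=
    (hE.clm_comp (hβ.differentiable (by simp) q).hasFDerivAt).const_add (ℓ.smulRight u)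
  have hval : ∀ v w, fderiv ℝ (gaugeForm L u ℓ β) q v w
      = exp ((-ℓ q) • D) (fderiv ℝ β q v w)
        - ℓ v • bracket L u (exp ((-ℓ q) • D) (β q w)) := fun v w => by
    rw [hd.fderiv]
    simp [hD, bracketCLM_apply, sub_eq_add_neg]
  have h := congrArg (fun T => exp ((-ℓ q) • D) T) (hMC q v w)
  rw [map_add, map_sub, map_zero, hD, exp_smul_ad_bracket hL, ← hD] at h
  rw [hval, hval, ← h]
  simp only [gaugeForm, ← hD, add_apply, ContinuousLinearMap.smulRight_apply,
    ContinuousLinearMap.comp_apply, bracket_add_left, bracket_add_right, bracket_smul_left,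
    bracket_smul_right, bracket_self, smul_zero]
  rw [bracket_swap L (exp ((-ℓ q) • D) (β q v)) u]
  module

/-- The homogeneous space exists locally: the product `exp (q₁ u₁) exp (q₂ u₂) exp (q₃ u₃)
exp (q₄ u₄)` of one-parameter groups provides a section near the origin. -/
theorem exists_isLocalModel (hL : IsHomogeneousPair L) : ∃ U α, IsLocalModel L U α := by
  let step (i : Fin 4) (β : Tan → Tan →L[ℝ] Alg k) : Tan → Tan →L[ℝ] Alg k :=
    gaugeForm L (lift k (basisVec i)) (ContinuousLinearMap.proj i) β
  let α := step 3 (step 2 (step 1 (step 0 fun _ => 0)))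
  have hstep : ∀ i {β : Tan → Tan →L[ℝ] Alg k}, ContDiff ℝ ∞ β ∧ (∀ q v w,
      fderiv ℝ β q v w - fderiv ℝ β q w v + bracket L (β q v) (β q w) = 0) →
      ContDiff ℝ ∞ (step i β) ∧ (∀ q v w, fderiv ℝ (step i β) q v w
        - fderiv ℝ (step i β) q w v + bracket L (step i β q v) (step i β q w) = 0) :=
    fun i β h => ⟨contDiff_gaugeForm _ _ h.1, maurerCartan_gaugeForm hL _ _ h.1 h.2⟩
  have h0 : ContDiff ℝ ∞ (fun _ : Tan => (0 : Tan →L[ℝ] Alg k)) ∧ (∀ q v w : Tan,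
      fderiv ℝ (fun _ : Tan => (0 : Tan →L[ℝ] Alg k)) q v w
        - fderiv ℝ (fun _ : Tan => (0 : Tan →L[ℝ] Alg k)) q w v
        + bracket L ((0 : Tan →L[ℝ] Alg k) v) ((0 : Tan →L[ℝ] Alg k) w) = 0) :=
    ⟨contDiff_const, fun q v w => by simp [← bracketBilin_apply]⟩
  obtain ⟨hsm, hMC⟩ := hstep 3 (hstep 2 (hstep 1 (hstep 0 h0)))
  change ContDiff ℝ ∞ α at hsm
  have hframe : Continuous (frame α) := (contDiff_const.clm_comp hsm).continuous
  refine ⟨{q | (frame α q).IsInvertible}, α,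
    ContinuousLinearEquiv.isOpen.preimage hframe, ⟨0, ?_⟩, hsm.contDiffOn, fun q _ => hMC q,
    fun q hq => ?_⟩
  · refine ⟨ContinuousLinearEquiv.refl ℝ Tan, ?_⟩
    ext v i
    fin_cases i <;>
      simp [frame, α, step, gaugeForm, mPartLin_apply, mPart, lift, basisVec]
  · obtain ⟨e, he⟩ := hq
    change Function.Bijective (frame α q)
    rw [← he]
    exact e.bijective

end Existence

/-! ### Criteria for the examples -/

section Criteria

variable {k : ℕ} {L : BracketTable k} {B : Matrix (Fin 4) (Fin 4) ℝ} {Q : Tan →ₗ[ℝ] Tan}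

/-- A criterion for `∇R ≠ 0`. If `∇R = 0`, the Ricci tensor `ϱ`, being a trace of `R`, is parallel,
which fails as soon as `(∇_v ϱ)(v, v) = -2 ϱ(v, Λ(v) v) ≠ 0` for some `v`. -/
lemma exists_nablaCurv_ne_zero (hB : IsInvariantMetric L B)
    (hQ : IsRicciCurvature B (curv L B) Q) (v : Tan)
    (hv : form B (Q v) (conn L B (lift k v) v) ≠ 0) :
    ∃ v x y w, nablaCurv L B v x y w ≠ 0 := by
  by_contra! h
  let C := curvTrilin L hB.symm hB.nondegenerate
  let Λ : Tan →ₗ[ℝ] Tan := connBilin L hB.symm hB.nondegenerate (lift k v)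
  -- `A x y` is the endomorphism `z ↦ R(z, x) y`
  let A (x y : Tan) : Tan →ₗ[ℝ] Tan := (C.flip x).flip y
  have hA : ∀ x y, LinearMap.trace ℝ Tan (A x y) = form B (Q x) y := fun x y => by
    rw [← hQ.ricci_eq, trace_eq_sum]; rfl
  have hpar : Λ ∘ₗ A v v - A v v ∘ₗ Λ = A (Λ v) v + A v (Λ v) := by
    refine LinearMap.ext fun z => ?_
    rw [← sub_eq_zero, ← h v z v v]
    simp only [nablaCurv, A, C, Λ, LinearMap.sub_apply, LinearMap.add_apply, LinearMap.comp_apply,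
      LinearMap.flip_apply, curvTrilin_apply, connBilin_apply]
    abel
  have htr := congrArg (LinearMap.trace ℝ Tan) hpar
  rw [map_sub, LinearMap.trace_comp_comm', sub_self, map_add, hA, hA, hQ.selfAdjoint,
    form_comm hB.symm] at htr
  exact hv (by change form B (Q v) (Λ v) = 0; linarith)

lemma IsLocalModel.conformallyFlatOn {U : Set Tan} {α : Tan → Tan →L[ℝ] Alg k}
    (hα : IsLocalModel L U α) (hL : IsHomogeneousPair L) (hB : IsInvariantMetric L B)
    (hQ : IsRicciCurvature B (curv L B) Q) :
    ConformallyFlatOn U (modelMetric B α) (modelConn (connCLM L hB) α) := fun q hq =>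
  (hα.isRicciCurvature hL hB hQ hq).weyl_eq_zero ((hα.isPseudoMetric hB).symm q hq)
    ((hα.isPseudoMetric hB).nondegenerate q hq)

lemma IsLocalModel.nowhereSymmetricOn {U : Set Tan} {α : Tan → Tan →L[ℝ] Alg k}
    (hα : IsLocalModel L U α) (hL : IsHomogeneousPair L) (hB : IsInvariantMetric L B)
    (h : ∃ v x y w, nablaCurv L B v x y w ≠ 0) :
    NowhereSymmetricOn U (modelConn (connCLM L hB) α) := by
  intro q hq
  obtain ⟨u, x, y, w, h⟩ := h
  obtain ⟨u, rfl⟩ := hα.frame_surjective hq u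
  obtain ⟨x, rfl⟩ := hα.frame_surjective hq x
  obtain ⟨y, rfl⟩ := hα.frame_surjective hq y
  obtain ⟨w, rfl⟩ := hα.frame_surjective hq w
  refine ⟨u, x, y, w, fun h0 => h ?_⟩
  rw [← hα.frame_chartNablaCurv hL hB hq, h0, map_zero]

lemma isNonsymmetricExample_of_isRicciCurvature (hL : IsHomogeneousPair L)
    (hB : IsInvariantMetric L B) (hQ : IsRicciCurvature B (curv L B) Q) (v : Tan)
    (hv : form B (Q v) (conn L B (lift k v) v) ≠ 0) (X : Tan) (μ : ℝ)
    (hsol : ∀ y z, form B (mPart (bracket L (lift k X) (lift k y))) z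
      + form B y (mPart (bracket L (lift k X) (lift k z))) + form B (Q y) z = μ * form B y z) :
    IsNonsymmetricExample L B where
  pair := hL
  metric := hB
  soliton := ⟨X, μ, fun y z => by rw [hQ.ricci_eq, hsol]⟩
  weyl_eq_zero := hQ.weyl_eq_zero hB.symm hB.nondegenerate
  nablaCurv_ne_zero := exists_nablaCurv_ne_zero hB hQ v hv
  exists_model := exists_isLocalModel hL
  models U α hα := ⟨hα.isPseudoMetric hB, _, hα.isLeviCivita hL hB,
    hα.conformallyFlatOn hL hB hQ,
    hα.nowhereSymmetricOn hL hB (exists_nablaCurv_ne_zero hB hQ v hv)⟩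

lemma isNonsymmetricInvariantExample_of_isRicciCurvature (hL : IsHomogeneousPair L)
    (hB : IsInvariantMetric L B) (hQ : IsRicciCurvature B (curv L B) Q) (v : Tan)
    (hv : form B (Q v) (conn L B (lift k v) v) ≠ 0) (X : Tan) (μ : ℝ)
    (hX : IsInvariantVector L X)
    (hsol : ∀ y z, form B (mPart (bracket L (lift k X) (lift k y))) z
      + form B y (mPart (bracket L (lift k X) (lift k z))) + form B (Q y) z = μ * form B y z) :
    IsNonsymmetricInvariantExample L B where
  toIsNonsymmetricExample := isNonsymmetricExample_of_isRicciCurvature hL hB hQ v hv X μ hsol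
  invariantSoliton := ⟨X, μ, hX, fun y z => by rw [hQ.ricci_eq, hsol]⟩
  modelSoliton U α hα := ⟨_, hα.isLeviCivita hL hB,
    hα.ricciSolitonOn hL hB hQ hX fun y z => by rw [hQ.ricci_eq, hsol]⟩

lemma IsHomogeneousPair.of_components
    (jacobi : ∀ x y z i, (bracket L x (bracket L y z) + bracket L y (bracket L z x)
      + bracket L z (bracket L x y)) i = 0)
    (subalgebra : ∀ x y, mPart x = 0 → mPart y = 0 → ∀ i, mPart (bracket L x y) i = 0)
    (faithful : ∀ x, mPart x = 0 → (∀ j i, isotropy L x (basisVec j) i = 0) →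
      ∀ i, x (Sum.inl i) = 0) : IsHomogeneousPair L where
  jacobi x y z := funext (jacobi x y z)
  subalgebra x y hx hy := funext (subalgebra x y hx hy)
  faithful x hx h := by
    ext (i | i)
    · exact faithful x hx (fun j i => congrFun (h (basisVec j)) i) i
    · exact congrFun hx i

end Criteria

lemma inr_eq_zero {k : ℕ} {x : Alg k} (hx : mPart x = 0) (i : Fin 4) : x (Sum.inr i) = 0 :=
  congrFun hx i

/-- The endomorphism `κ θⁱ ⊗ uⱼ`, which maps `uᵢ` to `κ uⱼ` and the other basis vectors to `0`;
the indices count from `0`, so that `rankOne 0 1 κ` maps `u₁` to `κ u₂`. -/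
def rankOne (i j : Fin 4) (κ : ℝ) : Tan →ₗ[ℝ] Tan :=
  (LinearMap.proj i).smulRight (κ • basisVec j)

lemma rankOne_apply (i j : Fin 4) (κ : ℝ) (x : Tan) :
    rankOne i j κ x = x i • κ • basisVec j := rfl

/-- The case of a rank-one Ricci operator `κ θⁱ ⊗ uⱼ`; the vector `uⱼ` is null, as
`g(uⱼ, ·) = m θⁱ` with `i ≠ j`. -/
lemma isRicciCurvature_rankOne {B : Matrix (Fin 4) (Fin 4) ℝ} {R : Tan → Tan → Tan → Tan}
    {i j : Fin 4} {κ m : ℝ} (hB : B.IsSymm) (hij : i ≠ j)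
    (hj : ∀ y, form B (basisVec j) y = m * y i)
    (hR : ∀ x y w, R x y w = (1 / 2 * κ) • ((form B y w * x i - form B x w * y i) • basisVec j
      + (m * w i) • (y i • x - x i • y))) : IsRicciCurvature B R (rankOne i j κ) where
  trace_eq_zero := by simp [trace_eq_sum, rankOne_apply, basisVec, Pi.single_apply, hij]
  selfAdjoint x y := by
    rw [form_comm hB x]
    simp only [rankOne_apply, form_smul_left, hj]
    ring
  eq x y w := by
    rw [hR]
    simp only [rankOne_apply, form_smul_left, hj]
    module

/-! ### The invariant metrics -/

section Metrics

variable (a b c d : ℝ)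

lemma form_metric_1_1_1 (x y : Tan) : form (metric_1_1_1 a b c d) x y
    = a * (x 0 * y 2 + x 2 * y 0) + b * (x 1 * y 1) + c * (x 1 * y 3 + x 3 * y 1)
        + d * (x 3 * y 3) := by
  simp [form, metric_1_1_1, dotProduct, Matrix.mulVec, Fin.sum_univ_four]
  ring

lemma isSymm_metric_1_1_1 : (metric_1_1_1 a b c d).IsSymm := by
  ext i j
  fin_cases i <;> fin_cases j <;> rfl

lemma det_metric_1_1_1 : (metric_1_1_1 a b c d).det = a ^ 2 * (c ^ 2 - b * d) := by
  simp [metric_1_1_1, Matrix.det_succ_row_zero, Fin.sum_univ_succ, Fin.succAbove]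
  ring

lemma form_metric_1_1_2 (x y : Tan) : form (metric_1_1_2 a b c d) x y
    = a * (x 0 * y 0 + x 2 * y 2) + b * (x 1 * y 1) + c * (x 1 * y 3 + x 3 * y 1)
        + d * (x 3 * y 3) := by
  simp [form, metric_1_1_2, dotProduct, Matrix.mulVec, Fin.sum_univ_four]
  ring

lemma isSymm_metric_1_1_2 : (metric_1_1_2 a b c d).IsSymm := by
  ext i j
  fin_cases i <;> fin_cases j <;> rfl

lemma det_metric_1_1_2 : (metric_1_1_2 a b c d).det = a ^ 2 * (b * d - c ^ 2) := by
  simp [metric_1_1_2, Matrix.det_succ_row_zero, Fin.sum_univ_succ, Fin.succAbove]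
  ring

lemma form_metric_1_3_1 (x y : Tan) : form (metric_1_3_1 a b c d) x y
    = a * (x 0 * y 3 + x 3 * y 0) - a * (x 1 * y 2 + x 2 * y 1) + b * (x 2 * y 2)
        + c * (x 2 * y 3 + x 3 * y 2) + d * (x 3 * y 3) := by
  simp [form, metric_1_3_1, dotProduct, Matrix.mulVec, Fin.sum_univ_four]
  ring

lemma isSymm_metric_1_3_1 : (metric_1_3_1 a b c d).IsSymm := by
  ext i j
  fin_cases i <;> fin_cases j <;> rfl

lemma det_metric_1_3_1 : (metric_1_3_1 a b c d).det = a ^ 4 := by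
  simp [metric_1_3_1, Matrix.det_succ_row_zero, Fin.sum_univ_succ, Fin.succAbove]
  ring

lemma form_metric_1_4_1 (x y : Tan) : form (metric_1_4_1 a b c d) x y
    = -a * (x 0 * y 2 + x 2 * y 0) + a * (x 1 * y 1) + b * (x 2 * y 2)
        + c * (x 2 * y 3 + x 3 * y 2) + d * (x 3 * y 3) := by
  simp [form, metric_1_4_1, dotProduct, Matrix.mulVec, Fin.sum_univ_four]
  ring

lemma isSymm_metric_1_4_1 : (metric_1_4_1 a b c d).IsSymm := by
  ext i j
  fin_cases i <;> fin_cases j <;> rfl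

lemma det_metric_1_4_1 : (metric_1_4_1 a b c d).det = -(a ^ 3 * d) := by
  simp [metric_1_4_1, Matrix.det_succ_row_zero, Fin.sum_univ_succ, Fin.succAbove]
  ring

lemma form_metric_2_2_1 (x y : Tan) : form (metric_2_2_1 a b c) x y
    = a * (x 0 * y 2 + x 2 * y 0) + c * (x 1 * y 1) + a * (x 1 * y 3 + x 3 * y 1)
        + b * (x 2 * y 2) := by
  simp [form, metric_2_2_1, dotProduct, Matrix.mulVec, Fin.sum_univ_four]
  ring

lemma isSymm_metric_2_2_1 : (metric_2_2_1 a b c).IsSymm := by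
  ext i j
  fin_cases i <;> fin_cases j <;> rfl

lemma det_metric_2_2_1 : (metric_2_2_1 a b c).det = a ^ 4 := by
  simp [metric_2_2_1, Matrix.det_succ_row_zero, Fin.sum_univ_succ, Fin.succAbove]
  ring

lemma form_metric_3_3_1 (x y : Tan) : form (metric_3_3_1 a b) x y
    = a * (x 0 * y 2 + x 2 * y 0) + a * (x 1 * y 3 + x 3 * y 1) + b * (x 2 * y 2) := by
  simp [form, metric_3_3_1, dotProduct, Matrix.mulVec, Fin.sum_univ_four]
  ring

lemma isSymm_metric_3_3_1 : (metric_3_3_1 a b).IsSymm := by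
  ext i j
  fin_cases i <;> fin_cases j <;> rfl

lemma det_metric_3_3_1 : (metric_3_3_1 a b).det = a ^ 4 := by
  simp [metric_3_3_1, Matrix.det_succ_row_zero, Fin.sum_univ_succ, Fin.succAbove]
  ring

lemma form_metric_3_3_2 (x y : Tan) : form (metric_3_3_2 a b) x y
    = a * (x 0 * y 2 + x 2 * y 0) + a * (x 1 * y 1 + x 3 * y 3) + b * (x 2 * y 2) := by
  simp [form, metric_3_3_2, dotProduct, Matrix.mulVec, Fin.sum_univ_four]
  ring

lemma isSymm_metric_3_3_2 : (metric_3_3_2 a b).IsSymm := by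
  ext i j
  fin_cases i <;> fin_cases j <;> rfl

lemma det_metric_3_3_2 : (metric_3_3_2 a b).det = -a ^ 4 := by
  simp [metric_3_3_2, Matrix.det_succ_row_zero, Fin.sum_univ_succ, Fin.succAbove]
  ring

end Metrics

/-! ### The pair `1.1¹.1` -/

lemma bracket_1_1_1_1 (x y : Alg 1) : bracket pair_1_1_1_1 x y = Sum.elim
    ![0]
    ![x e1 * y u1 - x u1 * y e1,
      (x u1 * y u3 - x u3 * y u1) + (x u2 * y u4 - x u4 * y u2),
      -(x e1 * y u3 - x u3 * y e1) + (x u3 * y u4 - x u4 * y u3),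
      0] := by
  ext (i | i) <;> fin_cases i <;> simp [bracket, pair_1_1_1_1, vec]

lemma isHomogeneousPair_1_1_1_1 : IsHomogeneousPair pair_1_1_1_1 := by
  refine .of_components (fun x y z i => ?_) (fun x y hx hy i => ?_) (fun x hx h i => ?_)
  · rcases i with i | i <;> fin_cases i <;> simp [bracket_1_1_1_1] <;> ring
  · fin_cases i <;> simp [bracket_1_1_1_1, mPart, inr_eq_zero hx, inr_eq_zero hy]
  · fin_cases i
    simpa [isotropy, bracket_1_1_1_1, mPart, lift, basisVec, inr_eq_zero hx] using h 0 0

lemma isInvariantMetric_1_1_1_1 {a c d : ℝ} (ha : a ≠ 0) (hc : c ≠ 0) :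
    IsInvariantMetric pair_1_1_1_1 (metric_1_1_1 a 0 c d) where
  symm := isSymm_metric_1_1_1 ..
  nondegenerate := by simp [det_metric_1_1_1, ha, hc]
  invariant x hx y z := by
    simp [form_metric_1_1_1, isotropy, bracket_1_1_1_1, mPart, lift, inr_eq_zero hx]
    ring

lemma conn_1_1_1_1 {a c d : ℝ} (ha : a ≠ 0) (hc : c ≠ 0) (x : Alg 1) (w : Tan) :
    conn pair_1_1_1_1 (metric_1_1_1 a 0 c d) x w =
    ![x e1 * w 0 + (1 / 2 - c / (2 * a)) * x u1 * w 3 + (1 / 2 - c / (2 * a)) * x u4 * w 0,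
      (-a / (2 * c) + 1 / 2) * x u1 * w 2 + (-a / (2 * c) - 1 / 2) * x u3 * w 0 - x u4 * w 1
        - d / c * x u4 * w 3,
      -x e1 * w 2 + (1 / 2 + c / (2 * a)) * x u3 * w 3 + (-1 / 2 + c / (2 * a)) * x u4 * w 2,
      x u4 * w 3] := by
  have h : IsInvariantMetric pair_1_1_1_1 (metric_1_1_1 a 0 c d) :=
    isInvariantMetric_1_1_1_1 ha hc
  refine conn_eq_of_koszul h.symm h.nondegenerate fun z => ?_
  simp [koszul, form_metric_1_1_1, bracket_1_1_1_1, mPart, lift]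
  field_simp
  ring

lemma isRicciCurvature_1_1_1_1 {a c d : ℝ} (ha : a ≠ 0) (hc : c ≠ 0) :
    IsRicciCurvature (metric_1_1_1 a 0 c d)
      (curv pair_1_1_1_1 (metric_1_1_1 a 0 c d))
      (rankOne 3 1 ((a ^ 2 - c ^ 2) / (2 * a ^ 2 * c))) := by
  refine isRicciCurvature_rankOne (m := c) (isSymm_metric_1_1_1 ..) (by decide)
    (fun y => by simp [form_metric_1_1_1, basisVec]) fun x y w => ?_
  ext i
  fin_cases i <;>
    simp [curv, conn_1_1_1_1 ha hc, bracket_1_1_1_1, form_metric_1_1_1, basisVec, lift] <;>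
    field_simp <;> ring

lemma isNonsymmetricInvariantExample_1_1_1_1 {a c d : ℝ} (ha : a ≠ 0) (hc : c ≠ 0)
    (hca : c ^ 2 ≠ a ^ 2) :
    IsNonsymmetricInvariantExample pair_1_1_1_1 (metric_1_1_1 a 0 c d) := by
  refine isNonsymmetricInvariantExample_of_isRicciCurvature (isHomogeneousPair_1_1_1_1)
    (isInvariantMetric_1_1_1_1 ha hc) (isRicciCurvature_1_1_1_1 ha hc) (basisVec 3) ?_
    (((c ^ 2 - a ^ 2) / (4 * a ^ 2 * c)) • basisVec 1) 0 (fun x hx => ?_) (fun y z => ?_)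
  · simp [conn_1_1_1_1 ha hc, form_metric_1_1_1, rankOne_apply, basisVec, lift,
      ha, hc, sub_ne_zero.mpr hca.symm]
  · ext i
    fin_cases i <;>
      simp [isotropy, bracket_1_1_1_1, mPart, lift, basisVec, inr_eq_zero hx]
  · simp [bracket_1_1_1_1, form_metric_1_1_1, rankOne_apply, basisVec, mPart, lift]
    field_simp
    ring

/-! ### The pair `1.1².1` -/

lemma bracket_1_1_2_1 (x y : Alg 1) : bracket pair_1_1_2_1 x y = Sum.elim
    ![0]
    ![-(x e1 * y u3 - x u3 * y e1) + (x u1 * y u4 - x u4 * y u1),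
      -(x u1 * y u3 - x u3 * y u1) + 2 * (x u2 * y u4 - x u4 * y u2),
      (x e1 * y u1 - x u1 * y e1) + (x u3 * y u4 - x u4 * y u3),
      0] := by
  ext (i | i) <;> fin_cases i <;> simp [bracket, pair_1_1_2_1, vec] <;> ring

lemma isHomogeneousPair_1_1_2_1 : IsHomogeneousPair pair_1_1_2_1 := by
  refine .of_components (fun x y z i => ?_) (fun x y hx hy i => ?_) (fun x hx h i => ?_)
  · rcases i with i | i <;> fin_cases i <;> simp [bracket_1_1_2_1] <;> ring
  · fin_cases i <;> simp [bracket_1_1_2_1, mPart, inr_eq_zero hx, inr_eq_zero hy]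
  · fin_cases i
    simpa [isotropy, bracket_1_1_2_1, mPart, lift, basisVec, inr_eq_zero hx] using h 0 2

lemma isInvariantMetric_1_1_2_1 {a c d : ℝ} (ha : a ≠ 0) (hc : c ≠ 0) :
    IsInvariantMetric pair_1_1_2_1 (metric_1_1_2 a 0 c d) where
  symm := isSymm_metric_1_1_2 ..
  nondegenerate := by simp [det_metric_1_1_2, ha, hc]
  invariant x hx y z := by
    simp [form_metric_1_1_2, isotropy, bracket_1_1_2_1, mPart, lift, inr_eq_zero hx]
    ring

lemma conn_1_1_2_1 {a c d : ℝ} (ha : a ≠ 0) (hc : c ≠ 0) (x : Alg 1) (w : Tan) :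
    conn pair_1_1_2_1 (metric_1_1_2 a 0 c d) x w =
    ![-x e1 * w 2 + x u1 * w 3 - c / (2 * a) * x u3 * w 3 - c / (2 * a) * x u4 * w 2,
      -a / c * x u1 * w 0 - 1 / 2 * x u1 * w 2 + 1 / 2 * x u3 * w 0 - a / c * x u3 * w 2
        - 2 * x u4 * w 1 - 2 * d / c * x u4 * w 3,
      x e1 * w 0 + c / (2 * a) * x u1 * w 3 + x u3 * w 3 + c / (2 * a) * x u4 * w 0,
      2 * x u4 * w 3] := by
  have h : IsInvariantMetric pair_1_1_2_1 (metric_1_1_2 a 0 c d) :=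
    isInvariantMetric_1_1_2_1 ha hc
  refine conn_eq_of_koszul h.symm h.nondegenerate fun z => ?_
  simp [koszul, form_metric_1_1_2, bracket_1_1_2_1, mPart, lift]
  field_simp
  ring

lemma isRicciCurvature_1_1_2_1 {a c d : ℝ} (ha : a ≠ 0) (hc : c ≠ 0) :
    IsRicciCurvature (metric_1_1_2 a 0 c d)
      (curv pair_1_1_2_1 (metric_1_1_2 a 0 c d))
      (rankOne 3 1 ((c ^ 2 + 4 * a ^ 2) / (2 * a ^ 2 * c))) := by
  refine isRicciCurvature_rankOne (m := c) (isSymm_metric_1_1_2 ..) (by decide)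
    (fun y => by simp [form_metric_1_1_2, basisVec]) fun x y w => ?_
  ext i
  fin_cases i <;>
    simp [curv, conn_1_1_2_1 ha hc, bracket_1_1_2_1, form_metric_1_1_2, basisVec, lift] <;>
    field_simp <;> ring

lemma isNonsymmetricInvariantExample_1_1_2_1 {a c d : ℝ} (ha : a ≠ 0) (hc : c ≠ 0)  :
    IsNonsymmetricInvariantExample pair_1_1_2_1 (metric_1_1_2 a 0 c d) := by
  refine isNonsymmetricInvariantExample_of_isRicciCurvature (isHomogeneousPair_1_1_2_1)
    (isInvariantMetric_1_1_2_1 ha hc) (isRicciCurvature_1_1_2_1 ha hc) (basisVec 3) ?_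
    ((-((c ^ 2 + 4 * a ^ 2) / (8 * a ^ 2 * c))) • basisVec 1) 0 (fun x hx => ?_) (fun y z => ?_)
  · simp [conn_1_1_2_1 ha hc, form_metric_1_1_2, rankOne_apply, basisVec, lift,
      ha, hc, (by positivity : c ^ 2 + 4 * a ^ 2 ≠ 0)]
  · ext i
    fin_cases i <;>
      simp [isotropy, bracket_1_1_2_1, mPart, lift, basisVec, inr_eq_zero hx]
  · simp [bracket_1_1_2_1, form_metric_1_1_2, rankOne_apply, basisVec, mPart, lift]
    field_simp
    ring

/-! ### The pair `1.3¹.5` -/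

lemma bracket_1_3_1_5 (p : ℝ) (x y : Alg 1) : bracket (pair_1_3_1_5 p 0) x y = Sum.elim
    ![p ^ 2 * (x u1 * y u3 - x u3 * y u1) - p * (x u1 * y u4 - x u4 * y u1)
        - p * (x u2 * y u3 - x u3 * y u2)]
    ![(x e1 * y u3 - x u3 * y e1) + (x u1 * y u4 - x u4 * y u1) + (x u2 * y u3 - x u3 * y u2),
      (x e1 * y u4 - x u4 * y e1) + (-p ^ 2 - 1) * (x u1 * y u3 - x u3 * y u1)
        + p * (x u1 * y u4 - x u4 * y u1) + p * (x u2 * y u3 - x u3 * y u2)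
        + (x u2 * y u4 - x u4 * y u2),
      0,
      0] := by
  ext (i | i) <;> fin_cases i <;> simp [bracket, pair_1_3_1_5, vec] <;> ring

lemma isHomogeneousPair_1_3_1_5 (p : ℝ) : IsHomogeneousPair (pair_1_3_1_5 p 0) := by
  refine .of_components (fun x y z i => ?_) (fun x y hx hy i => ?_) (fun x hx h i => ?_)
  · rcases i with i | i <;> fin_cases i <;> simp [bracket_1_3_1_5] <;> ring
  · fin_cases i <;> simp [bracket_1_3_1_5, mPart, inr_eq_zero hx, inr_eq_zero hy]
  · fin_cases i
    simpa [isotropy, bracket_1_3_1_5, mPart, lift, basisVec, inr_eq_zero hx] using h 2 0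

lemma isInvariantMetric_1_3_1_5 {p a b d : ℝ} (ha : a ≠ 0) :
    IsInvariantMetric (pair_1_3_1_5 p 0) (metric_1_3_1 a b (-(p * d / 2)) d) where
  symm := isSymm_metric_1_3_1 ..
  nondegenerate := by simp [det_metric_1_3_1, ha]
  invariant x hx y z := by
    simp [form_metric_1_3_1, isotropy, bracket_1_3_1_5, mPart, lift, inr_eq_zero hx]
    ring

lemma conn_1_3_1_5 {p a b d : ℝ} (ha : a ≠ 0) (x : Alg 1) (w : Tan) :
    conn (pair_1_3_1_5 p 0) (metric_1_3_1 a b (-(p * d / 2)) d) x w =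
    ![x e1 * w 2 + p / 2 * x u1 * w 2 + x u2 * w 2 + p / 2 * x u3 * w 0
        + (-d * p ^ 2 / (2 * a) - d / a) * x u3 * w 2 + d * p / (2 * a) * x u3 * w 3
        - x u4 * w 0 + d * p / (2 * a) * x u4 * w 2 - d / a * x u4 * w 3,
      x e1 * w 3 + p / 2 * x u1 * w 3 + x u2 * w 3 + (p ^ 2 + 1) * x u3 * w 0 - p * x u3 * w 1
        + (b * p / a - d * p ^ 3 / (2 * a) - d * p / (2 * a)) * x u3 * w 2
        + d * p ^ 2 / (4 * a) * x u3 * w 3 - p / 2 * x u4 * w 0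
        + d * p ^ 2 / (4 * a) * x u4 * w 2 - d * p / (2 * a) * x u4 * w 3,
      p * x u3 * w 2,
      (p ^ 2 + 1) * x u3 * w 2 - p / 2 * x u3 * w 3 - p / 2 * x u4 * w 2 + x u4 * w 3] := by
  have h : IsInvariantMetric (pair_1_3_1_5 p 0) (metric_1_3_1 a b (-(p * d / 2)) d) :=
    isInvariantMetric_1_3_1_5 ha
  refine conn_eq_of_koszul h.symm h.nondegenerate fun z => ?_
  simp [koszul, form_metric_1_3_1, bracket_1_3_1_5, mPart, lift]
  field_simp
  ring

lemma isRicciCurvature_1_3_1_5 {p a b d : ℝ} (ha : a ≠ 0) :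
    IsRicciCurvature (metric_1_3_1 a b (-(p * d / 2)) d)
      (curv (pair_1_3_1_5 p 0) (metric_1_3_1 a b (-(p * d / 2)) d))
      (rankOne 2 1 (-((p ^ 2 + 4) / (2 * a)))) := by
  refine isRicciCurvature_rankOne (m := -a) (isSymm_metric_1_3_1 ..) (by decide)
    (fun y => by simp [form_metric_1_3_1, basisVec]) fun x y w => ?_
  ext i
  fin_cases i <;>
    simp [curv, conn_1_3_1_5 ha, bracket_1_3_1_5, form_metric_1_3_1, basisVec, lift] <;>
    field_simp <;> ring

lemma isNonsymmetricInvariantExample_1_3_1_5 {p a b d : ℝ} (ha : a ≠ 0) (hp : p ≠ 0) :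
    IsNonsymmetricInvariantExample (pair_1_3_1_5 p 0) (metric_1_3_1 a b (-(p * d / 2)) d) := by
  refine isNonsymmetricInvariantExample_of_isRicciCurvature (isHomogeneousPair_1_3_1_5 p)
    (isInvariantMetric_1_3_1_5 ha) (isRicciCurvature_1_3_1_5 ha) (basisVec 2) ?_
    (((p ^ 2 + 4) / (4 * a * p)) • basisVec 1) 0 (fun x hx => ?_) (fun y z => ?_)
  · simp [conn_1_3_1_5 ha, form_metric_1_3_1, rankOne_apply, basisVec, lift,
      ha, hp, (by positivity : p ^ 2 + 4 ≠ 0)]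
  · ext i
    fin_cases i <;>
      simp [isotropy, bracket_1_3_1_5, mPart, lift, basisVec, inr_eq_zero hx]
  · simp [bracket_1_3_1_5, form_metric_1_3_1, rankOne_apply, basisVec, mPart, lift]
    field_simp
    ring

/-! ### The pair `1.3¹.7` -/

lemma bracket_1_3_1_7 (x y : Alg 1) : bracket (pair_1_3_1_7 0) x y = Sum.elim
    ![(x u1 * y u3 - x u3 * y u1) - (x u1 * y u4 - x u4 * y u1) - (x u2 * y u3 - x u3 * y u2)]
    ![(x e1 * y u3 - x u3 * y e1) + (x u1 * y u4 - x u4 * y u1) + (x u2 * y u3 - x u3 * y u2),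
      (x e1 * y u4 - x u4 * y e1) - (x u1 * y u3 - x u3 * y u1) + (x u1 * y u4 - x u4 * y u1)
        + (x u2 * y u3 - x u3 * y u2) + (x u2 * y u4 - x u4 * y u2),
      0,
      0] := by
  ext (i | i) <;> fin_cases i <;> simp [bracket, pair_1_3_1_7, vec] <;> ring

lemma isHomogeneousPair_1_3_1_7 : IsHomogeneousPair (pair_1_3_1_7 0) := by
  refine .of_components (fun x y z i => ?_) (fun x y hx hy i => ?_) (fun x hx h i => ?_)
  · rcases i with i | i <;> fin_cases i <;> simp [bracket_1_3_1_7] <;> ring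
  · fin_cases i <;> simp [bracket_1_3_1_7, mPart, inr_eq_zero hx, inr_eq_zero hy]
  · fin_cases i
    simpa [isotropy, bracket_1_3_1_7, mPart, lift, basisVec, inr_eq_zero hx] using h 2 0

lemma isInvariantMetric_1_3_1_7 {a b d : ℝ} (ha : a ≠ 0) :
    IsInvariantMetric (pair_1_3_1_7 0) (metric_1_3_1 a b (-(d / 2)) d) where
  symm := isSymm_metric_1_3_1 ..
  nondegenerate := by simp [det_metric_1_3_1, ha]
  invariant x hx y z := by
    simp [form_metric_1_3_1, isotropy, bracket_1_3_1_7, mPart, lift, inr_eq_zero hx]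
    ring

lemma conn_1_3_1_7 {a b d : ℝ} (ha : a ≠ 0) (x : Alg 1) (w : Tan) :
    conn (pair_1_3_1_7 0) (metric_1_3_1 a b (-(d / 2)) d) x w =
    ![x e1 * w 2 + 1 / 2 * x u1 * w 2 + x u2 * w 2 + 1 / 2 * x u3 * w 0
        - d / (2 * a) * x u3 * w 2 + d / (2 * a) * x u3 * w 3 - x u4 * w 0
        + d / (2 * a) * x u4 * w 2 - d / a * x u4 * w 3,
      x e1 * w 3 + 1 / 2 * x u1 * w 3 + x u2 * w 3 + x u3 * w 0 - x u3 * w 1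
        + (b / a - d / (2 * a)) * x u3 * w 2 + d / (4 * a) * x u3 * w 3 - 1 / 2 * x u4 * w 0
        + d / (4 * a) * x u4 * w 2 - d / (2 * a) * x u4 * w 3,
      x u3 * w 2,
      x u3 * w 2 - 1 / 2 * x u3 * w 3 - 1 / 2 * x u4 * w 2 + x u4 * w 3] := by
  have h : IsInvariantMetric (pair_1_3_1_7 0) (metric_1_3_1 a b (-(d / 2)) d) :=
    isInvariantMetric_1_3_1_7 ha
  refine conn_eq_of_koszul h.symm h.nondegenerate fun z => ?_
  simp [koszul, form_metric_1_3_1, bracket_1_3_1_7, mPart, lift]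
  field_simp
  ring

lemma isRicciCurvature_1_3_1_7 {a b d : ℝ} (ha : a ≠ 0) :
    IsRicciCurvature (metric_1_3_1 a b (-(d / 2)) d)
      (curv (pair_1_3_1_7 0) (metric_1_3_1 a b (-(d / 2)) d))
      (rankOne 2 1 (-(1 / (2 * a)))) := by
  refine isRicciCurvature_rankOne (m := -a) (isSymm_metric_1_3_1 ..) (by decide)
    (fun y => by simp [form_metric_1_3_1, basisVec]) fun x y w => ?_
  ext i
  fin_cases i <;>
    simp [curv, conn_1_3_1_7 ha, bracket_1_3_1_7, form_metric_1_3_1, basisVec, lift] <;>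
    field_simp <;> ring

lemma isNonsymmetricInvariantExample_1_3_1_7 {a b d : ℝ} (ha : a ≠ 0)  :
    IsNonsymmetricInvariantExample (pair_1_3_1_7 0) (metric_1_3_1 a b (-(d / 2)) d) := by
  refine isNonsymmetricInvariantExample_of_isRicciCurvature (isHomogeneousPair_1_3_1_7)
    (isInvariantMetric_1_3_1_7 ha) (isRicciCurvature_1_3_1_7 ha) (basisVec 2) ?_
    ((1 / (4 * a)) • basisVec 1) 0 (fun x hx => ?_) (fun y z => ?_)
  · simp [conn_1_3_1_7 ha, form_metric_1_3_1, rankOne_apply, basisVec, lift,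
      ha]
  · ext i
    fin_cases i <;>
      simp [isotropy, bracket_1_3_1_7, mPart, lift, basisVec, inr_eq_zero hx]
  · simp [bracket_1_3_1_7, form_metric_1_3_1, rankOne_apply, basisVec, mPart, lift]
    field_simp
    ring

/-! ### The pair `1.3¹.19` -/

lemma bracket_1_3_1_19 (x y : Alg 1) : bracket pair_1_3_1_19 x y = Sum.elim
    ![-(x u2 * y u4 - x u4 * y u2)]
    ![(x e1 * y u3 - x u3 * y e1) + (x u1 * y u4 - x u4 * y u1) + (x u2 * y u3 - x u3 * y u2)
        + (x u2 * y u4 - x u4 * y u2),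
      (x e1 * y u4 - x u4 * y e1) + 2 * (x u2 * y u4 - x u4 * y u2),
      0,
      0] := by
  ext (i | i) <;> fin_cases i <;> simp [bracket, pair_1_3_1_19, vec] <;> ring

lemma isHomogeneousPair_1_3_1_19 : IsHomogeneousPair pair_1_3_1_19 := by
  refine .of_components (fun x y z i => ?_) (fun x y hx hy i => ?_) (fun x hx h i => ?_)
  · rcases i with i | i <;> fin_cases i <;> simp [bracket_1_3_1_19] <;> ring
  · fin_cases i <;> simp [bracket_1_3_1_19, mPart, inr_eq_zero hx, inr_eq_zero hy]
  · fin_cases i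
    simpa [isotropy, bracket_1_3_1_19, mPart, lift, basisVec, inr_eq_zero hx] using h 2 0

lemma isInvariantMetric_1_3_1_19 {a c d : ℝ} (ha : a ≠ 0) :
    IsInvariantMetric pair_1_3_1_19 (metric_1_3_1 a 0 c d) where
  symm := isSymm_metric_1_3_1 ..
  nondegenerate := by simp [det_metric_1_3_1, ha]
  invariant x hx y z := by
    simp [form_metric_1_3_1, isotropy, bracket_1_3_1_19, mPart, lift, inr_eq_zero hx]
    ring

lemma conn_1_3_1_19 {a c d : ℝ} (ha : a ≠ 0) (x : Alg 1) (w : Tan) :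
    conn pair_1_3_1_19 (metric_1_3_1 a 0 c d) x w =
    ![x e1 * w 2 + 3 / 2 * x u2 * w 2 + 1 / 2 * x u3 * w 1 - c / (2 * a) * x u3 * w 3
        - x u4 * w 0 - x u4 * w 1 - c / (2 * a) * x u4 * w 2 + (c / a - d / a) * x u4 * w 3,
      x e1 * w 3 + 3 / 2 * x u2 * w 3 - 1 / 2 * x u4 * w 1 + c / a * x u4 * w 3,
      1 / 2 * x u3 * w 3 + 1 / 2 * x u4 * w 2 - x u4 * w 3,
      x u4 * w 3] := by
  have h : IsInvariantMetric pair_1_3_1_19 (metric_1_3_1 a 0 c d) :=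
    isInvariantMetric_1_3_1_19 ha
  refine conn_eq_of_koszul h.symm h.nondegenerate fun z => ?_
  simp [koszul, form_metric_1_3_1, bracket_1_3_1_19, mPart, lift]
  field_simp
  ring

lemma isRicciCurvature_1_3_1_19 {a c d : ℝ} (ha : a ≠ 0) :
    IsRicciCurvature (metric_1_3_1 a 0 c d)
      (curv pair_1_3_1_19 (metric_1_3_1 a 0 c d))
      (rankOne 3 0 (1 / (2 * a))) := by
  refine isRicciCurvature_rankOne (m := a) (isSymm_metric_1_3_1 ..) (by decide)
    (fun y => by simp [form_metric_1_3_1, basisVec]) fun x y w => ?_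
  ext i
  fin_cases i <;>
    simp [curv, conn_1_3_1_19 ha, bracket_1_3_1_19, form_metric_1_3_1, basisVec, lift] <;>
    field_simp <;> ring

lemma isNonsymmetricInvariantExample_1_3_1_19 {a c d : ℝ} (ha : a ≠ 0)  :
    IsNonsymmetricInvariantExample pair_1_3_1_19 (metric_1_3_1 a 0 c d) := by
  refine isNonsymmetricInvariantExample_of_isRicciCurvature (isHomogeneousPair_1_3_1_19)
    (isInvariantMetric_1_3_1_19 ha) (isRicciCurvature_1_3_1_19 ha) (basisVec 3) ?_
    ((-(1 / (4 * a))) • basisVec 0) 0 (fun x hx => ?_) (fun y z => ?_)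
  · simp [conn_1_3_1_19 ha, form_metric_1_3_1, rankOne_apply, basisVec, lift,
      ha]
  · ext i
    fin_cases i <;>
      simp [isotropy, bracket_1_3_1_19, mPart, lift, basisVec, inr_eq_zero hx]
  · simp [bracket_1_3_1_19, form_metric_1_3_1, rankOne_apply, basisVec, mPart, lift]
    field_simp
    ring

/-! ### The pair `1.3¹.21` -/

lemma bracket_1_3_1_21 (p : ℝ) (x y : Alg 1) : bracket (pair_1_3_1_21 p) x y = Sum.elim
    ![-p * (x u2 * y u4 - x u4 * y u2)]
    ![(x e1 * y u3 - x u3 * y e1) + (x u1 * y u4 - x u4 * y u1)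
        + p * (x u2 * y u3 - x u3 * y u2) + (-p + 1) * (x u2 * y u4 - x u4 * y u2),
      (x e1 * y u4 - x u4 * y e1) + (p + 1) * (x u2 * y u4 - x u4 * y u2),
      (-p + 1) * (x u3 * y u4 - x u4 * y u3),
      0] := by
  ext (i | i) <;> fin_cases i <;> simp [bracket, pair_1_3_1_21, vec] <;> ring

lemma isHomogeneousPair_1_3_1_21 (p : ℝ) : IsHomogeneousPair (pair_1_3_1_21 p) := by
  refine .of_components (fun x y z i => ?_) (fun x y hx hy i => ?_) (fun x hx h i => ?_)
  · rcases i with i | i <;> fin_cases i <;> simp [bracket_1_3_1_21] <;> ring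
  · fin_cases i <;> simp [bracket_1_3_1_21, mPart, inr_eq_zero hx, inr_eq_zero hy]
  · fin_cases i
    simpa [isotropy, bracket_1_3_1_21, mPart, lift, basisVec, inr_eq_zero hx] using h 2 0

lemma isInvariantMetric_1_3_1_21 {p a b c d : ℝ} (ha : a ≠ 0) :
    IsInvariantMetric (pair_1_3_1_21 p) (metric_1_3_1 a b c d) where
  symm := isSymm_metric_1_3_1 ..
  nondegenerate := by simp [det_metric_1_3_1, ha]
  invariant x hx y z := by
    simp [form_metric_1_3_1, isotropy, bracket_1_3_1_21, mPart, lift, inr_eq_zero hx]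
    ring

lemma conn_1_3_1_21 {p a b c d : ℝ} (ha : a ≠ 0) (x : Alg 1) (w : Tan) :
    conn (pair_1_3_1_21 p) (metric_1_3_1 a b c d) x w =
    ![x e1 * w 2 + (p / 2 + 1) * x u2 * w 2 + (-p / 2 + 1) * x u3 * w 1
        + (b * p / a - b / a) * x u3 * w 2 + (c * p / (2 * a) - c / a) * x u3 * w 3 - x u4 * w 0
        + (p - 1) * x u4 * w 1 + (c * p / (2 * a) - c / a) * x u4 * w 2
        + (-c * p / a + c / a - d / a) * x u4 * w 3,
      x e1 * w 3 + (p / 2 + 1) * x u2 * w 3 + b * p / (2 * a) * x u3 * w 3 - p / 2 * x u4 * w 1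
        + b * p / (2 * a) * x u4 * w 2 + (b * p / a - b / a + c * p / a) * x u4 * w 3,
      (-p / 2 + 1) * x u3 * w 3 + p / 2 * x u4 * w 2 + (p - 1) * x u4 * w 3,
      x u4 * w 3] := by
  have h : IsInvariantMetric (pair_1_3_1_21 p) (metric_1_3_1 a b c d) :=
    isInvariantMetric_1_3_1_21 ha
  refine conn_eq_of_koszul h.symm h.nondegenerate fun z => ?_
  simp [koszul, form_metric_1_3_1, bracket_1_3_1_21, mPart, lift]
  field_simp
  ring

lemma isRicciCurvature_1_3_1_21 {p a b c d : ℝ} (ha : a ≠ 0) (hb : p = 1 / 2 ∨ b = 0) :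
    IsRicciCurvature (metric_1_3_1 a b c d)
      (curv (pair_1_3_1_21 p) (metric_1_3_1 a b c d))
      (rankOne 3 0 (p * (2 - p) / (2 * a))) := by
  refine isRicciCurvature_rankOne (m := a) (isSymm_metric_1_3_1 ..) (by decide)
    (fun y => by simp [form_metric_1_3_1, basisVec]) fun x y w => ?_
  rcases hb with rfl | rfl <;> ext i <;> fin_cases i <;>
    simp [curv, conn_1_3_1_21 ha, bracket_1_3_1_21, form_metric_1_3_1, basisVec, lift] <;>
    field_simp <;> ring

lemma isNonsymmetricInvariantExample_1_3_1_21 {p a b c d : ℝ} (ha : a ≠ 0)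
    (hp0 : p ≠ 0) (hp2 : p ≠ 2) (hb : p = 1 / 2 ∨ b = 0) :
    IsNonsymmetricInvariantExample (pair_1_3_1_21 p) (metric_1_3_1 a b c d) := by
  refine isNonsymmetricInvariantExample_of_isRicciCurvature (isHomogeneousPair_1_3_1_21 p)
    (isInvariantMetric_1_3_1_21 ha) (isRicciCurvature_1_3_1_21 ha hb) (basisVec 3) ?_
    ((-(p * (2 - p) / (4 * a))) • basisVec 0) 0 (fun x hx => ?_) (fun y z => ?_)
  · simp [conn_1_3_1_21 ha, form_metric_1_3_1, rankOne_apply, basisVec, lift,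
      ha, hp0, sub_ne_zero.mpr hp2.symm]
  · ext i
    fin_cases i <;>
      simp [isotropy, bracket_1_3_1_21, mPart, lift, basisVec, inr_eq_zero hx]
  · simp [bracket_1_3_1_21, form_metric_1_3_1, rankOne_apply, basisVec, mPart, lift]
    field_simp
    ring

/-! ### The pair `1.3¹.28` -/

lemma bracket_1_3_1_28 (x y : Alg 1) : bracket pair_1_3_1_28 x y = Sum.elim
    ![x u2 * y u4 - x u4 * y u2]
    ![(x e1 * y u3 - x u3 * y e1) + 2 * (x u1 * y u3 - x u3 * y u1)
        - 1 / 2 * (x u2 * y u4 - x u4 * y u2),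
      (x e1 * y u4 - x u4 * y e1) + 2 * (x u1 * y u4 - x u4 * y u1)
        + (x u2 * y u3 - x u3 * y u2),
      0,
      x u3 * y u4 - x u4 * y u3] := by
  ext (i | i) <;> fin_cases i <;> simp [bracket, pair_1_3_1_28, vec] <;> ring

lemma isHomogeneousPair_1_3_1_28 : IsHomogeneousPair pair_1_3_1_28 := by
  refine .of_components (fun x y z i => ?_) (fun x y hx hy i => ?_) (fun x hx h i => ?_)
  · rcases i with i | i <;> fin_cases i <;> simp [bracket_1_3_1_28] <;> ring
  · fin_cases i <;> simp [bracket_1_3_1_28, mPart, inr_eq_zero hx, inr_eq_zero hy]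
  · fin_cases i
    simpa [isotropy, bracket_1_3_1_28, mPart, lift, basisVec, inr_eq_zero hx] using h 2 0

lemma isInvariantMetric_1_3_1_28 {a d : ℝ} (ha : a ≠ 0) :
    IsInvariantMetric pair_1_3_1_28 (metric_1_3_1 a (2 * d) 0 d) where
  symm := isSymm_metric_1_3_1 ..
  nondegenerate := by simp [det_metric_1_3_1, ha]
  invariant x hx y z := by
    simp [form_metric_1_3_1, isotropy, bracket_1_3_1_28, mPart, lift, inr_eq_zero hx]
    ring

lemma conn_1_3_1_28 {a d : ℝ} (ha : a ≠ 0) (x : Alg 1) (w : Tan) :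
    conn pair_1_3_1_28 (metric_1_3_1 a (2 * d) 0 d) x w =
    ![x e1 * w 2 + 3 / 2 * x u1 * w 2 - 1 / 2 * x u3 * w 0 - d / (2 * a) * x u3 * w 3
        + 1 / 2 * x u4 * w 1 - d / (2 * a) * x u4 * w 2,
      x e1 * w 3 + 3 / 2 * x u1 * w 3 - x u3 * w 1 + 2 * d / a * x u3 * w 2 - 1 / 2 * x u4 * w 0,
      x u3 * w 2 + 1 / 2 * x u4 * w 3,
      1 / 2 * x u3 * w 3 - 1 / 2 * x u4 * w 2] := by
  have h : IsInvariantMetric pair_1_3_1_28 (metric_1_3_1 a (2 * d) 0 d) :=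
    isInvariantMetric_1_3_1_28 ha
  refine conn_eq_of_koszul h.symm h.nondegenerate fun z => ?_
  simp [koszul, form_metric_1_3_1, bracket_1_3_1_28, mPart, lift]
  field_simp
  ring

lemma isRicciCurvature_1_3_1_28 {a d : ℝ} (ha : a ≠ 0) :
    IsRicciCurvature (metric_1_3_1 a (2 * d) 0 d) (curv pair_1_3_1_28 (metric_1_3_1 a (2 * d) 0 d))
      (rankOne 2 1 (3 / (2 * a)) + rankOne 3 0 (-(1 / (2 * a)))) where
  trace_eq_zero := by
    simp [trace_eq_sum, rankOne_apply, basisVec, Fin.sum_univ_four]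
  selfAdjoint x y := by
    simp only [form_metric_1_3_1, LinearMap.add_apply, rankOne_apply, Pi.add_apply]
    simp [basisVec]
    ring
  eq x y w := by
    ext i
    fin_cases i <;>
      simp [curv, conn_1_3_1_28 ha, bracket_1_3_1_28, form_metric_1_3_1, rankOne_apply, basisVec,
        lift] <;>
      field_simp <;> ring

lemma isNonsymmetricExample_1_3_1_28 {a d : ℝ} (ha : a ≠ 0) (hd : d ≠ 0) :
    IsNonsymmetricExample pair_1_3_1_28 (metric_1_3_1 a (2 * d) 0 d) := by
  refine isNonsymmetricExample_of_isRicciCurvature isHomogeneousPair_1_3_1_28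
    (isInvariantMetric_1_3_1_28 ha) (isRicciCurvature_1_3_1_28 ha) (basisVec 2) ?_
    ![0, -(7 / (8 * a)), -(1 / (8 * d)), 0] (1 / (8 * d)) (fun y z => ?_)
  -- `ϱ` is the diagonal `-3/2 θ₃² - 1/2 θ₄²`, so an isotropy-invariant `X = x₁ u₁ + x₂ u₂` would
  -- need `μ = 0`, `-2 a x₂ = 3/2` and `-a x₂ = 1/2`; the `u₃`-component repairs this and forces
  -- `μ = -x₃` through the entries of the metric that involve `a`
  · simp [conn_1_3_1_28 ha, form_metric_1_3_1, rankOne_apply, basisVec, lift, ha]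
  · simp [bracket_1_3_1_28, form_metric_1_3_1, rankOne_apply, basisVec, mPart, lift]
    field_simp
    ring

/-! ### The pair `1.4¹.9` -/

lemma bracket_1_4_1_9 (p r : ℝ) (x y : Alg 1) : bracket (pair_1_4_1_9 p r) x y = Sum.elim
    ![r * (x u2 * y u3 - x u3 * y u2)]
    ![(x e1 * y u2 - x u2 * y e1) + (x u1 * y u3 - x u3 * y u1),
      (x e1 * y u3 - x u3 * y e1) + (x u2 * y u3 - x u3 * y u2),
      0,
      (x u2 * y u3 - x u3 * y u2) + p * (x u3 * y u4 - x u4 * y u3)] := by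
  ext (i | i) <;> fin_cases i <;> simp [bracket, pair_1_4_1_9, vec] <;> ring

lemma isHomogeneousPair_1_4_1_9 (p r : ℝ) : IsHomogeneousPair (pair_1_4_1_9 p r) := by
  refine .of_components (fun x y z i => ?_) (fun x y hx hy i => ?_) (fun x hx h i => ?_)
  · rcases i with i | i <;> fin_cases i <;> simp [bracket_1_4_1_9] <;> ring
  · fin_cases i <;> simp [bracket_1_4_1_9, mPart, inr_eq_zero hx, inr_eq_zero hy]
  · fin_cases i
    simpa [isotropy, bracket_1_4_1_9, mPart, lift, basisVec, inr_eq_zero hx] using h 1 0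

lemma isInvariantMetric_1_4_1_9 {p r a b c d : ℝ} (ha : a ≠ 0) (hd : d ≠ 0) :
    IsInvariantMetric (pair_1_4_1_9 p r) (metric_1_4_1 a b c d) where
  symm := isSymm_metric_1_4_1 ..
  nondegenerate := by simp [det_metric_1_4_1, ha, hd]
  invariant x hx y z := by
    simp [form_metric_1_4_1, isotropy, bracket_1_4_1_9, mPart, lift, inr_eq_zero hx]
    ring

lemma conn_1_4_1_9 {p r a b c d : ℝ} (ha : a ≠ 0) (hd : d ≠ 0) (x : Alg 1) (w : Tan) :
    conn (pair_1_4_1_9 p r) (metric_1_4_1 a b c d) x w =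
    ![x e1 * w 1 + x u2 * w 1 + c / (2 * a) * x u2 * w 2 + d / (2 * a) * x u2 * w 3 - x u3 * w 0
        + c / (2 * a) * x u3 * w 1
        + (b / a - c ^ 2 * p / (a * d) - c ^ 2 / (a * d)) * x u3 * w 2 - c * p / a * x u3 * w 3
        + d / (2 * a) * x u4 * w 1 - c * p / a * x u4 * w 2 - d * p / a * x u4 * w 3,
      x e1 * w 2 + x u2 * w 2 + c / a * x u3 * w 2 + d / (2 * a) * x u3 * w 3
        + d / (2 * a) * x u4 * w 2,
      x u3 * w 2,
      1 / 2 * x u2 * w 2 - 1 / 2 * x u3 * w 1 + (-c * p / d - c / d) * x u3 * w 2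
        - p * x u4 * w 2] := by
  have h : IsInvariantMetric (pair_1_4_1_9 p r) (metric_1_4_1 a b c d) :=
    isInvariantMetric_1_4_1_9 ha hd
  refine conn_eq_of_koszul h.symm h.nondegenerate fun z => ?_
  simp [koszul, form_metric_1_4_1, bracket_1_4_1_9, mPart, lift]
  field_simp
  ring

lemma isRicciCurvature_1_4_1_9 {p r a b c d : ℝ} (ha : a ≠ 0) (hd : d ≠ 0) (hp : p = -(1 / 2))
    (hr : r = -((a + 4 * d) / (4 * a))) :
    IsRicciCurvature (metric_1_4_1 a b c d)
      (curv (pair_1_4_1_9 p r) (metric_1_4_1 a b c d))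
      (rankOne 2 0 (-((a + d) / (2 * a ^ 2)))) := by
  refine isRicciCurvature_rankOne (m := -a) (isSymm_metric_1_4_1 ..) (by decide)
    (fun y => by simp [form_metric_1_4_1, basisVec]) fun x y w => ?_
  ext i
  fin_cases i <;>
    simp [curv, conn_1_4_1_9 ha hd, bracket_1_4_1_9, form_metric_1_4_1, basisVec, lift] <;>
    subst hp hr <;> field_simp <;> ring

lemma isNonsymmetricInvariantExample_1_4_1_9 {p r a b c d : ℝ} (ha : a ≠ 0) (hd : d ≠ 0)
    (hp : p = -(1 / 2))
    (hr : r = -((a + 4 * d) / (4 * a))) (had : a + d ≠ 0) :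
    IsNonsymmetricInvariantExample (pair_1_4_1_9 p r) (metric_1_4_1 a b c d) := by
  refine isNonsymmetricInvariantExample_of_isRicciCurvature (isHomogeneousPair_1_4_1_9 p r)
    (isInvariantMetric_1_4_1_9 ha hd) (isRicciCurvature_1_4_1_9 ha hd hp hr) (basisVec 2) ?_
    (((a + d) / (4 * a ^ 2)) • basisVec 0) 0 (fun x hx => ?_) (fun y z => ?_)
  · simp [conn_1_4_1_9 ha hd, form_metric_1_4_1, rankOne_apply, basisVec, lift,
      ha, had]
  · ext i
    fin_cases i <;>
      simp [isotropy, bracket_1_4_1_9, mPart, lift, basisVec, inr_eq_zero hx]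
  · simp [bracket_1_4_1_9, form_metric_1_4_1, rankOne_apply, basisVec, mPart, lift]
    field_simp
    ring

/-! ### The pair `2.2¹.2` -/

lemma bracket_2_2_1_2 (p : ℝ) (x y : Alg 2) : bracket (pair_2_2_1_2 p) x y = Sum.elim
    ![0, (x e1 * y e2 - x e2 * y e1) + (x u1 * y u2 - x u2 * y u1)]
    ![(x e1 * y u1 - x u1 * y e1) + (x e2 * y u2 - x u2 * y e2),
      0,
      -(x e1 * y u3 - x u3 * y e1) + (p - 1) * (x u2 * y u3 - x u3 * y u2),
      -(x e2 * y u3 - x u3 * y e2) + (x u1 * y u3 - x u3 * y u1)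
        + p * (x u2 * y u4 - x u4 * y u2)] := by
  ext (i | i) <;> fin_cases i <;> simp [bracket, pair_2_2_1_2, vec] <;> ring

lemma isHomogeneousPair_2_2_1_2 (p : ℝ) : IsHomogeneousPair (pair_2_2_1_2 p) := by
  refine .of_components (fun x y z i => ?_) (fun x y hx hy i => ?_) (fun x hx h i => ?_)
  · rcases i with i | i <;> fin_cases i <;> simp [bracket_2_2_1_2] <;> ring
  · fin_cases i <;> simp [bracket_2_2_1_2, mPart, inr_eq_zero hx, inr_eq_zero hy]
  · fin_cases i
    · simpa [isotropy, bracket_2_2_1_2, mPart, lift, basisVec, inr_eq_zero hx] using h 0 0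
    · simpa [isotropy, bracket_2_2_1_2, mPart, lift, basisVec, inr_eq_zero hx] using h 1 0

lemma isInvariantMetric_2_2_1_2 {p a c : ℝ} (ha : a ≠ 0) :
    IsInvariantMetric (pair_2_2_1_2 p) (metric_2_2_1 a 0 c) where
  symm := isSymm_metric_2_2_1 ..
  nondegenerate := by simp [det_metric_2_2_1, ha]
  invariant x hx y z := by
    simp [form_metric_2_2_1, isotropy, bracket_2_2_1_2, mPart, lift, inr_eq_zero hx]
    ring

lemma conn_2_2_1_2 {p a c : ℝ} (ha : a ≠ 0) (x : Alg 2) (w : Tan) :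
    conn (pair_2_2_1_2 p) (metric_2_2_1 a 0 c) x w =
    ![x e1 * w 0 + x e2 * w 1 - p / 2 * x u1 * w 1 - p / 2 * x u2 * w 0,
      -p * x u2 * w 1,
      -x e1 * w 2 + p / 2 * x u2 * w 2 + (-p / 2 + 1) * x u3 * w 1,
      -x e2 * w 2 + p / 2 * x u1 * w 2 + c * p / a * x u2 * w 1 + p * x u2 * w 3
        + (p / 2 - 1) * x u3 * w 0] := by
  have h : IsInvariantMetric (pair_2_2_1_2 p) (metric_2_2_1 a 0 c) :=
    isInvariantMetric_2_2_1_2 ha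
  refine conn_eq_of_koszul h.symm h.nondegenerate fun z => ?_
  simp [koszul, form_metric_2_2_1, bracket_2_2_1_2, mPart, lift]
  field_simp
  ring

lemma isRicciCurvature_2_2_1_2 {p a c : ℝ} (ha : a ≠ 0) :
    IsRicciCurvature (metric_2_2_1 a 0 c)
      (curv (pair_2_2_1_2 p) (metric_2_2_1 a 0 c))
      (rankOne 1 3 ((p ^ 2 - 4) / (2 * a))) := by
  refine isRicciCurvature_rankOne (m := a) (isSymm_metric_2_2_1 ..) (by decide)
    (fun y => by simp [form_metric_2_2_1, basisVec]) fun x y w => ?_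
  ext i
  fin_cases i <;>
    simp [curv, conn_2_2_1_2 ha, bracket_2_2_1_2, form_metric_2_2_1, basisVec, lift] <;>
    field_simp <;> ring

lemma isNonsymmetricInvariantExample_2_2_1_2 {p a c : ℝ} (ha : a ≠ 0)
    (hp0 : p ≠ 0) (hp4 : p ^ 2 - 4 ≠ 0) :
    IsNonsymmetricInvariantExample (pair_2_2_1_2 p) (metric_2_2_1 a 0 c) := by
  refine isNonsymmetricInvariantExample_of_isRicciCurvature (isHomogeneousPair_2_2_1_2 p)
    (isInvariantMetric_2_2_1_2 ha) (isRicciCurvature_2_2_1_2 ha) (basisVec 1) ?_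
    (((p ^ 2 - 4) / (4 * a * p)) • basisVec 3) 0 (fun x hx => ?_) (fun y z => ?_)
  · simp [conn_2_2_1_2 ha, form_metric_2_2_1, rankOne_apply, basisVec, lift,
      ha, hp0, hp4]
  · ext i
    fin_cases i <;>
      simp [isotropy, bracket_2_2_1_2, mPart, lift, basisVec, inr_eq_zero hx]
  · simp [bracket_2_2_1_2, form_metric_2_2_1, rankOne_apply, basisVec, mPart, lift]
    field_simp
    ring

/-! ### The pair `2.2¹.3` -/

lemma bracket_2_2_1_3 (x y : Alg 2) : bracket pair_2_2_1_3 x y = Sum.elim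
    ![0, x e1 * y e2 - x e2 * y e1]
    ![(x e1 * y u1 - x u1 * y e1) + (x e2 * y u2 - x u2 * y e2),
      0,
      -(x e1 * y u3 - x u3 * y e1) + (x u2 * y u3 - x u3 * y u2),
      -(x e2 * y u3 - x u3 * y e2) + (x u2 * y u4 - x u4 * y u2)] := by
  ext (i | i) <;> fin_cases i <;> simp [bracket, pair_2_2_1_3, vec]

lemma isHomogeneousPair_2_2_1_3 : IsHomogeneousPair pair_2_2_1_3 := by
  refine .of_components (fun x y z i => ?_) (fun x y hx hy i => ?_) (fun x hx h i => ?_)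
  · rcases i with i | i <;> fin_cases i <;> simp [bracket_2_2_1_3] <;> ring
  · fin_cases i <;> simp [bracket_2_2_1_3, mPart, inr_eq_zero hx, inr_eq_zero hy]
  · fin_cases i
    · simpa [isotropy, bracket_2_2_1_3, mPart, lift, basisVec, inr_eq_zero hx] using h 0 0
    · simpa [isotropy, bracket_2_2_1_3, mPart, lift, basisVec, inr_eq_zero hx] using h 1 0

lemma isInvariantMetric_2_2_1_3 {a c : ℝ} (ha : a ≠ 0) :
    IsInvariantMetric pair_2_2_1_3 (metric_2_2_1 a 0 c) where
  symm := isSymm_metric_2_2_1 ..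
  nondegenerate := by simp [det_metric_2_2_1, ha]
  invariant x hx y z := by
    simp [form_metric_2_2_1, isotropy, bracket_2_2_1_3, mPart, lift, inr_eq_zero hx]
    ring

lemma conn_2_2_1_3 {a c : ℝ} (ha : a ≠ 0) (x : Alg 2) (w : Tan) :
    conn pair_2_2_1_3 (metric_2_2_1 a 0 c) x w =
    ![x e1 * w 0 + x e2 * w 1 - 1 / 2 * x u1 * w 1 - 1 / 2 * x u2 * w 0,
      -x u2 * w 1,
      -x e1 * w 2 + 1 / 2 * x u2 * w 2 - 1 / 2 * x u3 * w 1,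
      -x e2 * w 2 + 1 / 2 * x u1 * w 2 + c / a * x u2 * w 1 + x u2 * w 3 + 1 / 2 * x u3 * w 0] := by
  have h : IsInvariantMetric pair_2_2_1_3 (metric_2_2_1 a 0 c) :=
    isInvariantMetric_2_2_1_3 ha
  refine conn_eq_of_koszul h.symm h.nondegenerate fun z => ?_
  simp [koszul, form_metric_2_2_1, bracket_2_2_1_3, mPart, lift]
  field_simp
  ring

lemma isRicciCurvature_2_2_1_3 {a c : ℝ} (ha : a ≠ 0) :
    IsRicciCurvature (metric_2_2_1 a 0 c)
      (curv pair_2_2_1_3 (metric_2_2_1 a 0 c))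
      (rankOne 1 3 (1 / (2 * a))) := by
  refine isRicciCurvature_rankOne (m := a) (isSymm_metric_2_2_1 ..) (by decide)
    (fun y => by simp [form_metric_2_2_1, basisVec]) fun x y w => ?_
  ext i
  fin_cases i <;>
    simp [curv, conn_2_2_1_3 ha, bracket_2_2_1_3, form_metric_2_2_1, basisVec, lift] <;>
    field_simp <;> ring

lemma isNonsymmetricInvariantExample_2_2_1_3 {a c : ℝ} (ha : a ≠ 0)  :
    IsNonsymmetricInvariantExample pair_2_2_1_3 (metric_2_2_1 a 0 c) := by
  refine isNonsymmetricInvariantExample_of_isRicciCurvature (isHomogeneousPair_2_2_1_3)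
    (isInvariantMetric_2_2_1_3 ha) (isRicciCurvature_2_2_1_3 ha) (basisVec 1) ?_
    ((1 / (4 * a)) • basisVec 3) 0 (fun x hx => ?_) (fun y z => ?_)
  · simp [conn_2_2_1_3 ha, form_metric_2_2_1, rankOne_apply, basisVec, lift,
      ha]
  · ext i
    fin_cases i <;>
      simp [isotropy, bracket_2_2_1_3, mPart, lift, basisVec, inr_eq_zero hx]
  · simp [bracket_2_2_1_3, form_metric_2_2_1, rankOne_apply, basisVec, mPart, lift]
    field_simp
    ring

/-! ### The pair `3.3¹.1` -/

lemma bracket_3_3_1_1 (p : ℝ) (x y : Alg 3) : bracket (pair_3_3_1_1 p) x y = Sum.elim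
    ![0,
      -(x e1 * y e2 - x e2 * y e1) - p * (x u3 * y u4 - x u4 * y u3),
      (x e1 * y e3 - x e3 * y e1) + p * (x u2 * y u3 - x u3 * y u2)]
    ![(x e2 * y u2 - x u2 * y e2) + (x e3 * y u4 - x u4 * y e3) + (x u1 * y u3 - x u3 * y u1),
      (x e1 * y u2 - x u2 * y e1) - (x e3 * y u3 - x u3 * y e3) + (x u2 * y u3 - x u3 * y u2),
      0,
      -(x e1 * y u4 - x u4 * y e1) - (x e2 * y u3 - x u3 * y e2)
        - (x u3 * y u4 - x u4 * y u3)] := by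
  ext (i | i) <;> fin_cases i <;> simp [bracket, pair_3_3_1_1, vec] <;> ring

lemma isHomogeneousPair_3_3_1_1 (p : ℝ) : IsHomogeneousPair (pair_3_3_1_1 p) := by
  refine .of_components (fun x y z i => ?_) (fun x y hx hy i => ?_) (fun x hx h i => ?_)
  · rcases i with i | i <;> fin_cases i <;> simp [bracket_3_3_1_1] <;> ring
  · fin_cases i <;> simp [bracket_3_3_1_1, mPart, inr_eq_zero hx, inr_eq_zero hy]
  · fin_cases i
    · simpa [isotropy, bracket_3_3_1_1, mPart, lift, basisVec, inr_eq_zero hx] using h 1 1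
    · simpa [isotropy, bracket_3_3_1_1, mPart, lift, basisVec, inr_eq_zero hx] using h 1 0
    · simpa [isotropy, bracket_3_3_1_1, mPart, lift, basisVec, inr_eq_zero hx] using h 3 0

lemma isInvariantMetric_3_3_1_1 {p a b : ℝ} (ha : a ≠ 0) :
    IsInvariantMetric (pair_3_3_1_1 p) (metric_3_3_1 a b) where
  symm := isSymm_metric_3_3_1 ..
  nondegenerate := by simp [det_metric_3_3_1, ha]
  invariant x hx y z := by
    simp [form_metric_3_3_1, isotropy, bracket_3_3_1_1, mPart, lift, inr_eq_zero hx]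
    ring

lemma conn_3_3_1_1 {p a b : ℝ} (ha : a ≠ 0) (x : Alg 3) (w : Tan) :
    conn (pair_3_3_1_1 p) (metric_3_3_1 a b) x w =
    ![x e2 * w 1 + x e3 * w 3 - x u2 * w 3 - x u3 * w 0 - b / a * x u3 * w 2 - x u4 * w 1,
      x e1 * w 1 - x e3 * w 2 + x u2 * w 2,
      x u3 * w 2,
      -x e1 * w 3 - x e2 * w 2 + x u4 * w 2] := by
  have h : IsInvariantMetric (pair_3_3_1_1 p) (metric_3_3_1 a b) :=
    isInvariantMetric_3_3_1_1 ha
  refine conn_eq_of_koszul h.symm h.nondegenerate fun z => ?_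
  simp [koszul, form_metric_3_3_1, bracket_3_3_1_1, mPart, lift]
  field_simp
  ring

lemma isRicciCurvature_3_3_1_1 {p a b : ℝ} (ha : a ≠ 0) :
    IsRicciCurvature (metric_3_3_1 a b)
      (curv (pair_3_3_1_1 p) (metric_3_3_1 a b))
      (rankOne 2 0 (2 * p / a)) := by
  refine isRicciCurvature_rankOne (m := a) (isSymm_metric_3_3_1 ..) (by decide)
    (fun y => by simp [form_metric_3_3_1, basisVec]) fun x y w => ?_
  ext i
  fin_cases i <;>
    simp [curv, conn_3_3_1_1 ha, bracket_3_3_1_1, form_metric_3_3_1, basisVec, lift] <;>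
    field_simp <;> ring

lemma isNonsymmetricInvariantExample_3_3_1_1 {p a b : ℝ} (ha : a ≠ 0) (hp : p ≠ 0) :
    IsNonsymmetricInvariantExample (pair_3_3_1_1 p) (metric_3_3_1 a b) := by
  refine isNonsymmetricInvariantExample_of_isRicciCurvature (isHomogeneousPair_3_3_1_1 p)
    (isInvariantMetric_3_3_1_1 ha) (isRicciCurvature_3_3_1_1 ha) (basisVec 2) ?_
    ((-(p / a)) • basisVec 0) 0 (fun x hx => ?_) (fun y z => ?_)
  · simp [conn_3_3_1_1 ha, form_metric_3_3_1, rankOne_apply, basisVec, lift,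
      ha, hp]
  · ext i
    fin_cases i <;>
      simp [isotropy, bracket_3_3_1_1, mPart, lift, basisVec, inr_eq_zero hx]
  · simp [bracket_3_3_1_1, form_metric_3_3_1, rankOne_apply, basisVec, mPart, lift]
    field_simp
    ring

/-! ### The pair `3.3².1` -/

lemma bracket_3_3_2_1 (p : ℝ) (x y : Alg 3) : bracket (pair_3_3_2_1 p) x y = Sum.elim
    ![0,
      (x e1 * y e3 - x e3 * y e1) + p * (x u2 * y u3 - x u3 * y u2),
      -(x e1 * y e2 - x e2 * y e1) + p * (x u3 * y u4 - x u4 * y u3)]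
    ![(x e2 * y u2 - x u2 * y e2) - (x e3 * y u4 - x u4 * y e3) + (x u1 * y u3 - x u3 * y u1),
      -(x e1 * y u4 - x u4 * y e1) - (x e2 * y u3 - x u3 * y e2) + (x u2 * y u3 - x u3 * y u2),
      0,
      (x e1 * y u2 - x u2 * y e1) + (x e3 * y u3 - x u3 * y e3) - (x u3 * y u4 - x u4 * y u3)] := by
  ext (i | i) <;> fin_cases i <;> simp [bracket, pair_3_3_2_1, vec] <;> ring

lemma isHomogeneousPair_3_3_2_1 (p : ℝ) : IsHomogeneousPair (pair_3_3_2_1 p) := by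
  refine .of_components (fun x y z i => ?_) (fun x y hx hy i => ?_) (fun x hx h i => ?_)
  · rcases i with i | i <;> fin_cases i <;> simp [bracket_3_3_2_1] <;> ring
  · fin_cases i <;> simp [bracket_3_3_2_1, mPart, inr_eq_zero hx, inr_eq_zero hy]
  · fin_cases i
    · simpa [isotropy, bracket_3_3_2_1, mPart, lift, basisVec, inr_eq_zero hx] using h 1 3
    · simpa [isotropy, bracket_3_3_2_1, mPart, lift, basisVec, inr_eq_zero hx] using h 1 0
    · simpa [isotropy, bracket_3_3_2_1, mPart, lift, basisVec, inr_eq_zero hx] using h 3 0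

lemma isInvariantMetric_3_3_2_1 {p a b : ℝ} (ha : a ≠ 0) :
    IsInvariantMetric (pair_3_3_2_1 p) (metric_3_3_2 a b) where
  symm := isSymm_metric_3_3_2 ..
  nondegenerate := by simp [det_metric_3_3_2, ha]
  invariant x hx y z := by
    simp [form_metric_3_3_2, isotropy, bracket_3_3_2_1, mPart, lift, inr_eq_zero hx]
    ring

lemma conn_3_3_2_1 {p a b : ℝ} (ha : a ≠ 0) (x : Alg 3) (w : Tan) :
    conn (pair_3_3_2_1 p) (metric_3_3_2 a b) x w =
    ![x e2 * w 1 - x e3 * w 3 - x u2 * w 1 - x u3 * w 0 - b / a * x u3 * w 2 - x u4 * w 3,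
      -x e1 * w 3 - x e2 * w 2 + x u2 * w 2,
      x u3 * w 2,
      x e1 * w 1 + x e3 * w 2 + x u4 * w 2] := by
  have h : IsInvariantMetric (pair_3_3_2_1 p) (metric_3_3_2 a b) :=
    isInvariantMetric_3_3_2_1 ha
  refine conn_eq_of_koszul h.symm h.nondegenerate fun z => ?_
  simp [koszul, form_metric_3_3_2, bracket_3_3_2_1, mPart, lift]
  field_simp
  ring

lemma isRicciCurvature_3_3_2_1 {p a b : ℝ} (ha : a ≠ 0) :
    IsRicciCurvature (metric_3_3_2 a b)
      (curv (pair_3_3_2_1 p) (metric_3_3_2 a b))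
      (rankOne 2 0 (2 * p / a)) := by
  refine isRicciCurvature_rankOne (m := a) (isSymm_metric_3_3_2 ..) (by decide)
    (fun y => by simp [form_metric_3_3_2, basisVec]) fun x y w => ?_
  ext i
  fin_cases i <;>
    simp [curv, conn_3_3_2_1 ha, bracket_3_3_2_1, form_metric_3_3_2, basisVec, lift] <;>
    field_simp <;> ring

lemma isNonsymmetricInvariantExample_3_3_2_1 {p a b : ℝ} (ha : a ≠ 0) (hp : p ≠ 0) :
    IsNonsymmetricInvariantExample (pair_3_3_2_1 p) (metric_3_3_2 a b) := by
  refine isNonsymmetricInvariantExample_of_isRicciCurvature (isHomogeneousPair_3_3_2_1 p)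
    (isInvariantMetric_3_3_2_1 ha) (isRicciCurvature_3_3_2_1 ha) (basisVec 2) ?_
    ((-(p / a)) • basisVec 0) 0 (fun x hx => ?_) (fun y z => ?_)
  · simp [conn_3_3_2_1 ha, form_metric_3_3_2, rankOne_apply, basisVec, lift,
      ha, hp]
  · ext i
    fin_cases i <;>
      simp [isotropy, bracket_3_3_2_1, mPart, lift, basisVec, inr_eq_zero hx]
  · simp [bracket_3_3_2_1, form_metric_3_3_2, rankOne_apply, basisVec, mPart, lift]
    field_simp
    ring

/-! ### A homogeneous metric on `ℝ⁴` -/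

section Global

/-- The endomorphism `diag(1, 1, r, r)`. -/
def scaling (r : ℝ) : Tan →L[ℝ] Tan :=
  LinearMap.toContinuousLinearMap (Matrix.toLin' (Matrix.diagonal ![1, 1, 0, 0]))
    + r • LinearMap.toContinuousLinearMap (Matrix.toLin' (Matrix.diagonal ![0, 0, 1, 1]))

lemma scaling_apply (r : ℝ) (v : Tan) : scaling r v = ![v 0, v 1, r * v 2, r * v 3] := by
  ext i
  fin_cases i <;> simp [scaling, Matrix.mulVec_diagonal]

lemma scaling_scaling (r s : ℝ) (v : Tan) : scaling r (scaling s v) = scaling (r * s) v := by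
  simp [scaling_apply, mul_assoc]

lemma scaling_one (v : Tan) : scaling 1 v = v := by
  ext i
  fin_cases i <;> simp [scaling_apply]

/-- In the pair `2.2¹.3` the complement `𝔪` is the Lie algebra of a group `ℝ × (ℝ ⋉ ℝ²)`, which acts
simply transitively on the homogeneous space. This is its Maurer–Cartan form
`dx u₁ + dy u₂ + e⁻ʸ dz u₃ + e⁻ʸ dt u₄` in global coordinates `(x, y, z, t)`. -/
def globalForm (q : Tan) : Tan →L[ℝ] Alg 2 :=
  (LinearMap.toContinuousLinearMap (liftLin 2)).comp (scaling (Real.exp (-q 1)))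

lemma frame_globalForm (q v : Tan) : frame globalForm q v = scaling (Real.exp (-q 1)) v := rfl

lemma isLocalModel_globalForm : IsLocalModel pair_2_2_1_3 Set.univ globalForm where
  isOpen := isOpen_univ
  nonempty := Set.univ_nonempty
  smooth := by
    have h : ContDiff ℝ ∞ fun q : Tan => scaling (Real.exp (-q 1)) :=
      contDiff_const.add ((contDiff_apply ℝ ℝ (1 : Fin 4)).neg.exp.smul contDiff_const)
    exact (contDiff_const.clm_comp h).contDiffOn
  maurerCartan q _ v w := by
    have h1 : HasFDerivAt (fun q : Tan => Real.exp (-q 1)) _ q :=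
      (hasFDerivAt_apply (𝕜 := ℝ) (1 : Fin 4) q).neg.exp
    have h : HasFDerivAt globalForm _ q := (hasFDerivAt_const _ q).clm_comp
      ((h1.smul_const _).const_add _)
    have hd : ∀ v w, fderiv ℝ globalForm q v w
        = -(Real.exp (-q 1) * v 1) • lift 2 ![0, 0, w 2, w 3] := fun v w => by
      rw [h.fderiv]
      ext (i | i) <;> fin_cases i <;>
        simp [liftLin_apply, lift, Matrix.mulVec_diagonal]
    rw [hd, hd]
    ext (i | i) <;> fin_cases i <;>
      simp [globalForm, bracket_2_2_1_3, scaling_apply, liftLin_apply, lift] <;> ring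
  soldering q _ := by
    refine Function.bijective_iff_has_inverse.mpr
      ⟨scaling (Real.exp (q 1)), fun v => ?_, fun v => ?_⟩
    · change scaling _ (scaling _ v) = v
      rw [scaling_scaling, ← Real.exp_add, add_neg_cancel, Real.exp_zero, scaling_one]
    · change scaling _ (scaling _ v) = v
      rw [scaling_scaling, ← Real.exp_add, neg_add_cancel, Real.exp_zero, scaling_one]

/-- The left translations of the group act by the affine maps
`(x, y, z, t) ↦ (x + c₁, y + c₂, e^{c₂} z + c₃, e^{c₂} t + c₄)`. -/
lemma isHomogeneousMetric_globalForm (B : Matrix (Fin 4) (Fin 4) ℝ) :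
    IsHomogeneousMetric (modelMetric B globalForm) := by
  intro p q
  set r : ℝ := q 1 - p 1 with hr
  let φ : Tan ≃ Tan :=
    { toFun s := scaling (Real.exp r) (s - p) + q
      invFun s := scaling (Real.exp (-r)) (s - q) + p
      left_inv s := by
        simp only [add_sub_cancel_right]
        rw [scaling_scaling, ← Real.exp_add, neg_add_cancel, Real.exp_zero, scaling_one,
          sub_add_cancel]
      right_inv s := by
        simp only [add_sub_cancel_right]
        rw [scaling_scaling, ← Real.exp_add, add_neg_cancel, Real.exp_zero, scaling_one,
          sub_add_cancel] }
  have hφ : ∀ s, HasFDerivAt φ (scaling (Real.exp r)) s := fun s =>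
    ((scaling (Real.exp r)).hasFDerivAt.comp s ((hasFDerivAt_id s).sub_const p)).add_const q
  refine ⟨φ, ((scaling _).contDiff.comp (contDiff_id.sub contDiff_const)).add contDiff_const,
    ((scaling _).contDiff.comp (contDiff_id.sub contDiff_const)).add contDiff_const, ?_,
    fun s v w => ?_⟩
  · change scaling _ (p - p) + q = q
    rw [sub_self, map_zero, zero_add]
  · have h1 : φ s 1 = s 1 + r := by
      change scaling _ (s - p) 1 + q 1 = s 1 + r
      rw [scaling_apply, hr]
      simp only [Matrix.cons_val, Pi.sub_apply]
      ring
    have h2 : ∀ v, frame globalForm (φ s) (scaling (Real.exp r) v) = frame globalForm s v := by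
      intro v
      rw [frame_globalForm, frame_globalForm, h1, scaling_scaling, ← Real.exp_add]
      congr 3
      ring
    rw [(hφ s).fderiv, form_modelMetric, form_modelMetric, h2, h2]

end Global

end HomSoliton

end

theorem corollary4p3 :
    -- 1.1¹.1
    (∀ a c d : ℝ, a ≠ 0 → c ≠ 0 → c ^ 2 ≠ a ^ 2 →
      HomSoliton.IsNonsymmetricInvariantExample HomSoliton.pair_1_1_1_1
        (HomSoliton.metric_1_1_1 a 0 c d)) ∧
    -- 1.1².1
    (∀ a c d : ℝ, a ≠ 0 → c ≠ 0 →
      HomSoliton.IsNonsymmetricInvariantExample HomSoliton.pair_1_1_2_1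
        (HomSoliton.metric_1_1_2 a 0 c d)) ∧
    -- 1.3¹.5
    (∀ p a b c d : ℝ, p ≠ 0 → a ≠ 0 → 2 * c = -(p * d) →
      HomSoliton.IsNonsymmetricInvariantExample (HomSoliton.pair_1_3_1_5 p 0)
        (HomSoliton.metric_1_3_1 a b c d)) ∧
    -- 1.3¹.7
    (∀ a b c d : ℝ, a ≠ 0 → 2 * c = -d →
      HomSoliton.IsNonsymmetricInvariantExample (HomSoliton.pair_1_3_1_7 0)
        (HomSoliton.metric_1_3_1 a b c d)) ∧
    -- 1.3¹.19
    (∀ a c d : ℝ, a ≠ 0 →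
      HomSoliton.IsNonsymmetricInvariantExample HomSoliton.pair_1_3_1_19
        (HomSoliton.metric_1_3_1 a 0 c d)) ∧
    -- 1.3¹.21
    (∀ p a b c d : ℝ, p ≠ 1 → p * (p - 2) ≠ 0 → a ≠ 0 → (p = 1 / 2 ∨ b = 0) →
      HomSoliton.IsNonsymmetricInvariantExample (HomSoliton.pair_1_3_1_21 p)
        (HomSoliton.metric_1_3_1 a b c d)) ∧
    -- 1.3¹.28
    (∀ a b d : ℝ, a ≠ 0 → b - 6 * d ≠ 0 → b = 2 * d →
      HomSoliton.IsNonsymmetricExample HomSoliton.pair_1_3_1_28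
        (HomSoliton.metric_1_3_1 a b 0 d)) ∧
    -- 1.4¹.9
    (∀ r a b c d : ℝ, a * d ≠ 0 → r = -((a + 4 * d) / (4 * a)) → a + d ≠ 0 →
      HomSoliton.IsNonsymmetricInvariantExample (HomSoliton.pair_1_4_1_9 (-(1 / 2)) r)
        (HomSoliton.metric_1_4_1 a b c d)) ∧
    -- 2.2¹.2
    (∀ p a c : ℝ, p ≠ 0 → p ≠ 2 → p ≠ -2 → a ≠ 0 →
      HomSoliton.IsNonsymmetricInvariantExample (HomSoliton.pair_2_2_1_2 p)
        (HomSoliton.metric_2_2_1 a 0 c)) ∧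
    -- 2.2¹.3
    (∀ a c : ℝ, a ≠ 0 →
      HomSoliton.IsNonsymmetricInvariantExample HomSoliton.pair_2_2_1_3
        (HomSoliton.metric_2_2_1 a 0 c)) ∧
    -- 3.3¹.1
    (∀ p a b : ℝ, p ≠ 0 → a ≠ 0 →
      HomSoliton.IsNonsymmetricInvariantExample (HomSoliton.pair_3_3_1_1 p)
        (HomSoliton.metric_3_3_1 a b)) ∧
    -- 3.3².1
    (∀ p a b : ℝ, p ≠ 0 → a ≠ 0 →
      HomSoliton.IsNonsymmetricInvariantExample (HomSoliton.pair_3_3_2_1 p)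
        (HomSoliton.metric_3_3_2 a b)) ∧
    -- conformally flat homogeneous Ricci solitons that are not symmetric exist
    (∃ (G : HomSoliton.Tan → Matrix (Fin 4) (Fin 4) ℝ)
        (Γ : HomSoliton.Tan → HomSoliton.Tan →L[ℝ] HomSoliton.Tan →L[ℝ] HomSoliton.Tan),
      HomSoliton.IsPseudoMetric Set.univ G ∧ HomSoliton.IsHomogeneousMetric G ∧
      HomSoliton.IsLeviCivita Set.univ G Γ ∧ HomSoliton.RicciSolitonOn Set.univ G Γ ∧
      HomSoliton.ConformallyFlatOn Set.univ G Γ ∧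
      HomSoliton.NowhereSymmetricOn Set.univ Γ) := by
  open HomSoliton in
  refine ⟨fun a c d ha hc hca => isNonsymmetricInvariantExample_1_1_1_1 ha hc hca,
    fun a c d ha hc => isNonsymmetricInvariantExample_1_1_2_1 ha hc,
    fun p a b c d hp ha h => ?_, fun a b c d ha h => ?_,
    fun a c d ha => isNonsymmetricInvariantExample_1_3_1_19 ha,
    fun p a b c d _ hp ha hb => isNonsymmetricInvariantExample_1_3_1_21 ha
      (left_ne_zero_of_mul hp) (sub_ne_zero.mp (right_ne_zero_of_mul hp)) hb,
    fun a b d ha hbd hb => ?_,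
    fun r a b c d had hr h => isNonsymmetricInvariantExample_1_4_1_9 (left_ne_zero_of_mul had)
      (right_ne_zero_of_mul had) rfl hr h,
    fun p a c hp0 hp2 hp2' ha => isNonsymmetricInvariantExample_2_2_1_2 ha hp0 fun h => ?_,
    fun a c ha => isNonsymmetricInvariantExample_2_2_1_3 ha,
    fun p a b hp ha => isNonsymmetricInvariantExample_3_3_1_1 ha hp,
    fun p a b hp ha => isNonsymmetricInvariantExample_3_3_2_1 ha hp, ?_⟩
  · obtain rfl : c = -(p * d / 2) := by linarith
    exact isNonsymmetricInvariantExample_1_3_1_5 ha hp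
  · obtain rfl : c = -(d / 2) := by linarith
    exact isNonsymmetricInvariantExample_1_3_1_7 ha
  · subst hb
    exact isNonsymmetricExample_1_3_1_28 ha (by rintro rfl; simp at hbd)
  · have h' : (p - 2) * (p + 2) = 0 := by linear_combination h
    rcases mul_eq_zero.mp h' with h' | h'
    · exact hp2 (by linarith)
    · exact hp2' (by linarith)
  · have hE : IsNonsymmetricInvariantExample pair_2_2_1_3 (metric_2_2_1 1 0 0) :=
      isNonsymmetricInvariantExample_2_2_1_3 one_ne_zero
    have hα := isLocalModel_globalForm
    have hQ := isRicciCurvature_2_2_1_3 (a := 1) (c := 0) one_ne_zero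
    obtain ⟨X, μ, hX, hsol⟩ := hE.invariantSoliton
    refine ⟨modelMetric (metric_2_2_1 1 0 0) globalForm,
      modelConn (connCLM pair_2_2_1_3 hE.metric) globalForm, hα.isPseudoMetric hE.metric,
      isHomogeneousMetric_globalForm _, hα.isLeviCivita hE.pair hE.metric,
      hα.ricciSolitonOn hE.pair hE.metric hQ hX hsol,
      hα.conformallyFlatOn hE.pair hE.metric hQ,
      hα.nowhereSymmetricOn hE.pair hE.metric hE.nablaCurv_ne_zero⟩
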